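/- **Theorem 4.** For $n\ge 1$ one observes $X=(X_1,\dots,X_n)$ with $X_i=\theta_i+\varepsilon_i$, $\varepsilon_1,\dots,\varepsilon_n$ i.i.d. $\mathcal N(0,1)$; $P_\theta$ denotes the law of $X$, $E_\theta$ the expectation under it, $\|\cdot\|$ the Euclidean norm on $\mathbb R^n$, and $\ell_0[s]=\{\theta\in\mathbb R^n:\ \#\{i:\theta_i\ne 0\}\le s\}$. Let $\lambda_0=5\sqrt{2\pi}\,n$ and $\lambda_1=0.05$, let $G_0=\mathrm{Lap}(\lambda_0)$ have density $\gamma_0(u)=\frac{\lambda_0}{2}e^{-\lambda_0|u|}$, and let $G_1=\mathrm{Cauchy}(1/\lambda_1)$ have density $\gamma_1(u)=\frac{\lambda_1}{\pi}(1+\lambda_1^2u^2)^{-1}$. For $\alpha\in[0,1]$ let $\Pi_\alpha=\bigotimes_{i=1}^n\{(1-\alpha)G_0+\alpha G_1\}$ be the spike and slab LASSO prior with Cauchy slab. With $\phi$ the standard normal density and $g_k(x)=\int\phi(x-u)\gamma_k(u)\,du$ for $k=0,1$, the posterior distribution is $$\Pi_\alpha[\,\cdot\,|\,X]=\bigotimes_{i=1}^n\big\{(1-a_\alpha(X_i))\,G_{0,X_i}+a_\alpha(X_i)\,G_{1,X_i}\big\},\qquad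 a_\alpha(x)=\frac{\alpha g_1(x)}{(1-\alpha)g_0(x)+\alpha g_1(x)},$$ where $G_{k,x}$ has density $u\mapsto\phi(x-u)\gamma_k(u)/g_k(x)$. For a constant $\mathcal C>0$ let $\hat\alpha=\hat\alpha(X)$ be a maximiser of the log-marginal likelihood $$\ell_n(\alpha;X)=\sum_{i=1}^n\log\big((1-\alpha)g_0(X_i)+\alpha g_1(X_i)\big)\quad\text{over }\alpha\in[\mathcal C\log n/n,\,1],$$ and let $\Pi_{\hat\alpha}[\,\cdot\,|\,X]$ be the plug-in posterior, that is $\Pi_\alpha[\,\cdot\,|\,X]$ at $\alpha=\hat\alpha(X)$. There exists $\mathcal C_0>0$ such that for every $\mathcal C\ge\mathcal C_0$ there exist $C>0$, $N_0>0$ and $c_0,c_1>0$ such that, for every $n\ge N_0$: 1. for every integer $s_n\ge 0$ with $c_1\log^2 n\le s_n\le c_0n$, $$\sup_{\theta_0\in\ell_0[s_n]}E_{\theta_0}\int\|\theta-\theta_0\|^2\,d\Pi_{\hat\alpha}(\theta\,|\,X)\le C\,s_n\log n;$$ 2. for every integer $s_n\ge 0$ with $s_n\le c_0n$, $$\sup_{\theta_0\in\ell_0[s_n]}E_{\theta_0}\int\|\theta-\theta_0\|^2\,d\Pi_{\hat\alpha}(\theta\,|\,X)\le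 C\,(s_n\log n+\log^3 n).$$ -/

import Mathlib

open MeasureTheory ProbabilityTheory
open scoped ENNReal

namespace SSL

noncomputable section

/-- The spike parameter `λ₀ = L₀ n`, with `L₀ = 5 √(2π)`. -/
def spikeParam (n : ℕ) : ℝ := 5 * √(2 * Real.pi) * n

/-- The slab parameter `λ₁ = 0.05`. -/
def slabParam : ℝ := 0.05

/-- The standard normal density `φ`. -/
def phi (x : ℝ) : ℝ := gaussianPDFReal 0 1 x

/-- The density `γ₀` of the Laplace distribution `G₀ = Lap(λ₀)`. -/
def spikeDensity (n : ℕ) (u : ℝ) : ℝ :=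
  spikeParam n / 2 * Real.exp (-(spikeParam n * |u|))

/-- The density `γ₁` of the Cauchy distribution `G₁` with location `0` and scale `1 / λ₁`. -/
def slabDensity (u : ℝ) : ℝ := cauchyPDFReal 0 (1 / slabParam).toNNReal u

/-- The convolution `∫ φ(x - u) γ(u) du` of `φ` with a density `γ`. -/
def convPhi (γ : ℝ → ℝ) (x : ℝ) : ℝ := ∫ u, phi (x - u) * γ u

/-- `g₀ = φ * γ₀`. -/
def g0 (n : ℕ) (x : ℝ) : ℝ := convPhi (spikeDensity n) x

/-- `g₁ = φ * γ₁`. -/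
def g1 (x : ℝ) : ℝ := convPhi slabDensity x

/-- The one-coordinate prior `(1 - α) G₀ + α G₁`. -/
def coordPrior (n : ℕ) (α : ℝ) : Measure ℝ :=
  ENNReal.ofReal (1 - α) • volume.withDensity (fun u => ENNReal.ofReal (spikeDensity n u)) +
    ENNReal.ofReal α • volume.withDensity (fun u => ENNReal.ofReal (slabDensity u))

/-- The spike and slab LASSO prior with Cauchy slab, `Π_α = ⊗ᵢ ((1 - α) G₀ + α G₁)`. -/
def prior (n : ℕ) (α : ℝ) : Measure (Fin n → ℝ) := Measure.pi fun _ => coordPrior n α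

/-- The posterior weight `a_α(x) = α g₁(x) / ((1 - α) g₀(x) + α g₁(x))`. -/
def postWeight (n : ℕ) (α x : ℝ) : ℝ := α * g1 x / ((1 - α) * g0 n x + α * g1 x)

/-- For a prior density `γ`, the distribution with density
`γ_x(u) = φ(x - u) γ(u) / (φ * γ)(x)`. -/
def postComponent (γ : ℝ → ℝ) (x : ℝ) : Measure ℝ :=
  volume.withDensity fun u => ENNReal.ofReal (phi (x - u) * γ u / convPhi γ x)

/-- The one-coordinate posterior `(1 - a(x)) G_{0,x} + a(x) G_{1,x}`. -/
def coordPosterior (n : ℕ) (α x : ℝ) : Measure ℝ :=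
  ENNReal.ofReal (1 - postWeight n α x) • postComponent (spikeDensity n) x +
    ENNReal.ofReal (postWeight n α x) • postComponent slabDensity x

/-- The posterior distribution `Π_α[· | X] = ⊗ᵢ ((1 - a(Xᵢ)) G_{0,Xᵢ} + a(Xᵢ) G_{1,Xᵢ})`. It is
the Bayes posterior of `prior n α`, see `posterior_eq_bayes`. -/
def posterior (n : ℕ) (α : ℝ) (X : Fin n → ℝ) : Measure (Fin n → ℝ) :=
  Measure.pi fun i => coordPosterior n α (X i)

/-- The log-marginal likelihood `ℓ_n(α; X) = ∑ᵢ log ((1 - α) g₀(Xᵢ) + α g₁(Xᵢ))`. -/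
def logMarginal (n : ℕ) (α : ℝ) (X : Fin n → ℝ) : ℝ :=
  ∑ i, Real.log ((1 - α) * g0 n (X i) + α * g1 (X i))

/-- `αhat` is a marginal maximum likelihood estimator: for every observation `X`, the value
`αhat X` is a maximiser of `ℓ_n(·; X)` over the interval `[c log n / n, 1]`. -/
def IsMMLE (c : ℝ) (n : ℕ) (αhat : (Fin n → ℝ) → ℝ) : Prop :=
  ∀ X : Fin n → ℝ, αhat X ∈ Set.Icc (c * Real.log n / n) 1 ∧
    IsMaxOn (fun α => logMarginal n α X) (Set.Icc (c * Real.log n / n) 1) (αhat X)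

/-- The class `ℓ₀[s]` of vectors with at most `s` nonzero coordinates. -/
def sparseClass (n s : ℕ) : Set (Fin n → ℝ) :=
  {θ | (Finset.univ.filter fun i => θ i ≠ 0).card ≤ s}

/-- The law `P_θ` of `X = θ + ε` with `ε₁, …, ε_n` i.i.d. standard normal. -/
def sampleLaw {n : ℕ} (θ : Fin n → ℝ) : Measure (Fin n → ℝ) :=
  Measure.pi fun i => gaussianReal (θ i) 1

/-- The risk `E_{θ₀} ∫ ‖θ - θ₀‖² dΠ_{αhat}(θ | X)` of the plug-in posterior, with the squared
Euclidean norm, as an element of `[0, ∞]`. -/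
def plugInRisk {n : ℕ} (αhat : (Fin n → ℝ) → ℝ) (θ₀ : Fin n → ℝ) : ℝ≥0∞ :=
  ∫⁻ X, ∫⁻ θ, ENNReal.ofReal (∑ i, (θ i - θ₀ i) ^ 2) ∂(posterior n (αhat X) X) ∂(sampleLaw θ₀)

/-! ### Sanity facts: the densities, and Bayes' formula -/

lemma slabDensity_eq (u : ℝ) :
    slabDensity u = slabParam / Real.pi * (1 + slabParam ^ 2 * u ^ 2)⁻¹ := by
  have h : (0 : ℝ) ≤ 1 / slabParam := by norm_num [slabParam]
  rw [slabDensity, cauchyPDFReal_def', NNReal.coe_inv, Real.coe_toNNReal _ h]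
  norm_num [slabParam]
  ring

lemma spikeParam_pos {n : ℕ} (hn : 0 < n) : 0 < spikeParam n := by
  have : (0 : ℝ) < n := by exact_mod_cast hn
  unfold spikeParam
  positivity

lemma phi_pos (x : ℝ) : 0 < phi x := gaussianPDFReal_pos 0 1 x one_ne_zero

lemma measurable_phi : Measurable phi := measurable_gaussianPDFReal 0 1

lemma phi_le_one (x : ℝ) : phi x ≤ 1 := by
  unfold phi gaussianPDFReal
  have h1 : (1 : ℝ) ≤ √(2 * Real.pi * ((1 : NNReal) : ℝ)) := by
    rw [Real.one_le_sqrt]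
    have := Real.pi_gt_three
    simp only [NNReal.coe_one]
    linarith
  have h2 : Real.exp (-(x - 0) ^ 2 / (2 * ((1 : NNReal) : ℝ))) ≤ 1 := by
    rw [Real.exp_le_one_iff]
    simp only [NNReal.coe_one]
    nlinarith [sq_nonneg (x - 0)]
  exact mul_le_one₀ (inv_le_one_of_one_le₀ h1) (Real.exp_pos _).le h2

lemma slabDensity_pos (u : ℝ) : 0 < slabDensity u := by
  rw [slabDensity_eq]
  have := Real.pi_pos
  norm_num [slabParam]
  positivity

lemma spikeDensity_pos {n : ℕ} (hn : 0 < n) (u : ℝ) : 0 < spikeDensity n u := by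
  have := spikeParam_pos hn
  unfold spikeDensity
  positivity

lemma measurable_slabDensity : Measurable slabDensity := measurable_cauchyPDFReal _ _

lemma measurable_spikeDensity (n : ℕ) : Measurable (spikeDensity n) := by
  unfold spikeDensity
  fun_prop

lemma integral_slabDensity : ∫ u, slabDensity u = 1 :=
  integral_cauchyPDFReal_eq_one 0 (by norm_num [slabParam])

lemma integral_spikeDensity {n : ℕ} (hn : 0 < n) : ∫ u, spikeDensity n u = 1 := by
  have h := spikeParam_pos hn
  have h1 := integral_comp_abs (f := fun u => spikeParam n / 2 * Real.exp (-(spikeParam n) * u))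
  have h2 := integral_exp_mul_Ioi (a := -spikeParam n) (by linarith) 0
  simp only [spikeDensity, ← neg_mul]
  rw [h1, integral_const_mul, h2]
  simp
  field_simp

/-- Each mixture component of the posterior is obtained from Bayes' formula. -/
lemma component_bayes {γ : ℝ → ℝ} (hm : Measurable γ) (hpos : ∀ u, 0 < γ u)
    (hint : ∫ u, γ u = 1) (x : ℝ) :
    0 < convPhi γ x ∧ IsProbabilityMeasure (postComponent γ x) ∧
    IsProbabilityMeasure (volume.withDensity fun u => ENNReal.ofReal (γ u)) ∧
    (volume.withDensity fun u => ENNReal.ofReal (γ u)).withDensity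
        (fun u => ENNReal.ofReal (phi (x - u))) =
      ENNReal.ofReal (convPhi γ x) • postComponent γ x := by
  have hγ : Integrable γ := by
    by_contra h
    rw [integral_undef h] at hint
    norm_num at hint
  have hmp : Measurable fun u => phi (x - u) := measurable_phi.comp (by fun_prop)
  have hI : Integrable fun u => phi (x - u) * γ u := by
    refine hγ.mono (hmp.mul hm).aestronglyMeasurable (Filter.Eventually.of_forall fun u => ?_)
    rw [Real.norm_eq_abs, Real.norm_eq_abs, abs_mul, abs_of_pos (phi_pos _)]
    exact mul_le_of_le_one_left (abs_nonneg _) (phi_le_one _)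
  have hc : 0 < convPhi γ x := by
    unfold convPhi
    rw [integral_pos_iff_support_of_nonneg (fun u => (mul_pos (phi_pos _) (hpos u)).le) hI]
    have : (Function.support fun u => phi (x - u) * γ u) = Set.univ := by
      ext u
      simpa using ⟨(phi_pos _).ne', (hpos u).ne'⟩
    rw [this]
    simp
  refine ⟨hc, ⟨?_⟩, ⟨?_⟩, ?_⟩
  · rw [postComponent, withDensity_apply _ MeasurableSet.univ, Measure.restrict_univ,
      ← ofReal_integral_eq_lintegral_ofReal (hI.div_const _)
        (Filter.Eventually.of_forall fun u => div_nonneg (mul_pos (phi_pos _) (hpos u)).le hc.le),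
      integral_div]
    change ENNReal.ofReal (convPhi γ x / convPhi γ x) = 1
    rw [div_self hc.ne', ENNReal.ofReal_one]
  · rw [withDensity_apply _ MeasurableSet.univ, Measure.restrict_univ,
      ← ofReal_integral_eq_lintegral_ofReal hγ (Filter.Eventually.of_forall fun u => (hpos u).le),
      hint, ENNReal.ofReal_one]
  · rw [← withDensity_mul _ hm.ennreal_ofReal hmp.ennreal_ofReal, postComponent,
      ← withDensity_smul' _ _ ENNReal.ofReal_ne_top]
    congr 1
    ext u
    simp only [Pi.mul_apply, Pi.smul_apply, smul_eq_mul]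
    rw [← ENNReal.ofReal_mul (hpos u).le, ← ENNReal.ofReal_mul hc.le]
    congr 1
    field_simp

/-- One-coordinate Bayes' formula, with the marginal density `(1 - α) g₀ + α g₁`. -/
lemma coord_bayes {n : ℕ} (hn : 0 < n) {α : ℝ} (hα : α ∈ Set.Icc (0 : ℝ) 1) (x : ℝ) :
    0 < (1 - α) * g0 n x + α * g1 x ∧ IsProbabilityMeasure (coordPosterior n α x) ∧
    IsProbabilityMeasure (coordPrior n α) ∧
    (coordPrior n α).withDensity (fun u => ENNReal.ofReal (phi (x - u))) =
      ENNReal.ofReal ((1 - α) * g0 n x + α * g1 x) • coordPosterior n α x := by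
  obtain ⟨h0, p0, q0, e0⟩ :=
    component_bayes (measurable_spikeDensity n) (spikeDensity_pos hn) (integral_spikeDensity hn) x
  obtain ⟨h1, p1, q1, e1⟩ :=
    component_bayes measurable_slabDensity slabDensity_pos integral_slabDensity x
  change 0 < g0 n x at h0
  change 0 < g1 x at h1
  have hα0 := hα.1
  have hα1 : 0 ≤ 1 - α := by linarith [hα.2]
  have hm : 0 < (1 - α) * g0 n x + α * g1 x := by
    rcases hα0.eq_or_lt with h | h
    · rw [← h]; simpa using h0
    · have := mul_nonneg hα1 h0.le
      have := mul_pos h h1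
      linarith
  have ha0 : 0 ≤ postWeight n α x := div_nonneg (mul_nonneg hα0 h1.le) hm.le
  have ha : 1 - postWeight n α x = (1 - α) * g0 n x / ((1 - α) * g0 n x + α * g1 x) := by
    unfold postWeight
    field_simp
    ring
  have ha1 : 0 ≤ 1 - postWeight n α x := by
    rw [ha]
    exact div_nonneg (mul_nonneg hα1 h0.le) hm.le
  refine ⟨hm, ⟨?_⟩, ⟨?_⟩, ?_⟩
  · simp only [coordPosterior, Measure.add_apply, Measure.smul_apply, measure_univ, smul_eq_mul,
      mul_one]
    rw [← ENNReal.ofReal_add ha1 ha0]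
    simp
  · simp only [coordPrior, Measure.add_apply, Measure.smul_apply, measure_univ, smul_eq_mul,
      mul_one]
    rw [← ENNReal.ofReal_add hα1 hα0]
    simp
  · rw [coordPrior, withDensity_add_measure, withDensity_smul_measure, withDensity_smul_measure,
      e0, e1, coordPosterior, smul_add, smul_smul, smul_smul, smul_smul, smul_smul,
      ← ENNReal.ofReal_mul hα1, ← ENNReal.ofReal_mul hα0, ← ENNReal.ofReal_mul hm.le,
      ← ENNReal.ofReal_mul hm.le, ha, mul_div_cancel₀ _ hm.ne', postWeight,
      mul_div_cancel₀ _ hm.ne']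
    rfl

/-- The likelihood `θ ↦ ∏ᵢ φ(Xᵢ - θᵢ)` of the observation `X`. -/
def likelihood {n : ℕ} (X θ : Fin n → ℝ) : ℝ≥0∞ := ∏ i, ENNReal.ofReal (phi (X i - θ i))

lemma lintegral_likelihood_box {n : ℕ} (hn : 0 < n) {α : ℝ} (hα : α ∈ Set.Icc (0 : ℝ) 1)
    (X : Fin n → ℝ) {s : Fin n → Set ℝ} (hs : ∀ i, MeasurableSet (s i)) :
    ∫⁻ θ in Set.univ.pi s, likelihood X θ ∂(prior n α) =
      (∏ i, ENNReal.ofReal ((1 - α) * g0 n (X i) + α * g1 (X i))) *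
        ∏ i, coordPosterior n α (X i) (s i) := by
  have hp : IsProbabilityMeasure (coordPrior n α) := (coord_bayes hn hα 0).2.2.1
  have hmp : ∀ i, Measurable fun u => ENNReal.ofReal (phi (X i - u)) := fun i =>
    (measurable_phi.comp (by fun_prop)).ennreal_ofReal
  let f : Fin n → ℝ → ℝ≥0∞ := fun i => (s i).indicator fun u => ENNReal.ofReal (phi (X i - u))
  have hf : ∀ i, Measurable (f i) := fun i => (hmp i).indicator (hs i)
  have hind : iIndepFun (fun i (θ : Fin n → ℝ) => f i (θ i)) (prior n α) :=
    iIndepFun_pi fun i => (hf i).aemeasurable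
  have key := lintegral_prod_eq_prod_lintegral_of_indepFun Finset.univ _ hind
    (fun i => (hf i).comp (measurable_pi_apply i))
  have hL : ∀ θ : Fin n → ℝ,
      (Set.univ.pi s).indicator (likelihood X) θ = ∏ i, f i (θ i) := by
    intro θ
    by_cases h : θ ∈ Set.univ.pi s
    · rw [Set.indicator_of_mem h]
      refine Finset.prod_congr rfl fun i _ => ?_
      have h0 : f i (θ i) = ENNReal.ofReal (phi (X i - θ i)) :=
        Set.indicator_of_mem (h i (Set.mem_univ i)) _
      exact h0.symm
    · rw [Set.indicator_of_notMem h]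
      simp only [Set.mem_pi, Set.mem_univ, true_implies, not_forall] at h
      obtain ⟨i, hi⟩ := h
      have h0 : f i (θ i) = 0 :=
        Set.indicator_of_notMem (M := ℝ≥0∞) hi _
      exact (Finset.prod_eq_zero (Finset.mem_univ i) h0).symm
  rw [← lintegral_indicator (MeasurableSet.univ_pi hs), lintegral_congr hL, key,
    ← Finset.prod_mul_distrib]
  refine Finset.prod_congr rfl fun i _ => ?_
  have h1 : ∫⁻ θ, f i (θ i) ∂(prior n α) = ∫⁻ u, f i u ∂(coordPrior n α) :=
    (measurePreserving_eval (fun _ : Fin n => coordPrior n α) i).lintegral_comp (hf i)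
  rw [h1, lintegral_indicator (hs i), ← withDensity_apply _ (hs i), (coord_bayes hn hα (X i)).2.2.2]
  rfl

/-- Bayes' formula: the product form `posterior` is the prior, reweighted by the likelihood and
normalised. -/
theorem posterior_eq_bayes {n : ℕ} (hn : 0 < n) {α : ℝ} (hα : α ∈ Set.Icc (0 : ℝ) 1)
    (X : Fin n → ℝ) :
    posterior n α X = (∫⁻ θ, likelihood X θ ∂(prior n α))⁻¹ •
      (prior n α).withDensity (likelihood X) := by
  have hp : ∀ i, IsProbabilityMeasure (coordPosterior n α (X i)) := fun i =>
    (coord_bayes hn hα (X i)).2.1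
  have hZ := lintegral_likelihood_box hn hα X (s := fun _ => Set.univ) fun _ => MeasurableSet.univ
  simp only [Set.pi_univ, Measure.restrict_univ, measure_univ, Finset.prod_const_one,
    mul_one] at hZ
  refine Measure.pi_eq fun s hs => ?_
  rw [Measure.smul_apply, withDensity_apply _ (MeasurableSet.univ_pi hs),
    lintegral_likelihood_box hn hα X hs, hZ, smul_eq_mul, ← mul_assoc, ENNReal.inv_mul_cancel,
    one_mul]
  · exact Finset.prod_ne_zero_iff.2 fun i _ => by
      simpa using (coord_bayes hn hα (X i)).1
  · exact ENNReal.prod_ne_top fun i _ => ENNReal.ofReal_ne_top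

/-- A maximiser of the marginal likelihood exists whenever `0 < c log n / n ≤ 1`. -/
theorem exists_isMMLE {c : ℝ} {n : ℕ} (hn : 0 < n) (h0 : 0 < c * Real.log n / n)
    (h1 : c * Real.log n / n ≤ 1) : ∃ αhat : (Fin n → ℝ) → ℝ, IsMMLE c n αhat := by
  have key : ∀ X : Fin n → ℝ, ∃ a ∈ Set.Icc (c * Real.log n / n) 1,
      IsMaxOn (fun α => logMarginal n α X) (Set.Icc (c * Real.log n / n) 1) a := by
    intro X
    refine isCompact_Icc.exists_isMaxOn (Set.nonempty_Icc.2 h1) ?_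
    unfold logMarginal
    refine continuousOn_finsetSum _ fun i _ => ContinuousOn.log (by fun_prop) fun α hα => ?_
    exact (coord_bayes hn ⟨h0.le.trans hα.1, hα.2⟩ (X i)).1.ne'
  choose αhat h using key
  exact ⟨αhat, h⟩

end

end SSL

namespace SSL

noncomputable section

/-! ### Gaussian integrals -/

/-! The posterior is a product, so the risk is a sum of coordinate risks, and signal and null
coordinates are treated separately. At a signal, any weight `α ≥ 1/n` will do. The slab posterior
stays within bounded mean square distance of `x`, while the spike component, which shrinks, keeps
weight only when `x²` is of order `log n` at most (`one_sub_postWeight_mul_sq_le`). Each signal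
therefore costs `O(log n)` (`coordRisk_signal_le`). At a null, the spike contributes `O(n⁻²)` in
expectation, and the slab contributes `a_α(x)` times a quadratic. Since `φ a_α ≤ 4 α g₁` and the
Cauchy tail of `g₁` cancels the quadratic, integrating over `|x| ≤ T ≍ √(log n)` gives `O(α T)`,
with an `O(1/n)` remainder from the tail (`lintegral_postWeight_mul_le`). It remains to show that
the estimated weight rarely exceeds `α = K (s √(log n) + log² n) / n`; then `n α T` is at most of
order `s log n + log³ n`. By concavity, an excess forces the total score at `α` to be nonnegative.
Signals contribute at most `s / α` to it. A null score has mean at most `-c / T`: the bound `g₁ / g₀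
- 1` has mean at most `n⁻²` because the spike is nearly a point mass, and on `[T, 2T]`, where the
slab dominates, this bound overshoots by an amount of order the Cauchy tail mass `1 / T`. The second
moment of a null score is `O(1 / α)`, so Chernoff's bound with parameter of order `α / T` has
exponent of order `(s - n α / T) / T`, below `-2 log n` for `K` large (`lintegral_exp_score_le`,
`sq_mul_sampleLaw_score_event_le`). The exceptional event, of probability `n⁻²`, contributes `O(1)`
through a crude bound. When `s log n > n`, the trivial bound `O(n)` for the nulls suffices. -/

lemma phi_eq (x : ℝ) : phi x = (√(2 * Real.pi))⁻¹ * Real.exp (-x ^ 2 / 2) := by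
  simp [phi, gaussianPDFReal]

lemma integral_phi : ∫ x, phi x = 1 := integral_gaussianPDFReal_eq_one 0 one_ne_zero

lemma integrable_phi : Integrable phi := integrable_gaussianPDFReal 0 1

lemma phi_le_exp (x : ℝ) : phi x ≤ Real.exp (-x ^ 2 / 2) := by
  rw [phi_eq]
  refine mul_le_of_le_one_left (Real.exp_pos _).le (inv_le_one_of_one_le₀ ?_)
  rw [Real.one_le_sqrt]
  have := Real.pi_gt_three
  linarith

/-- Polynomial growth is dominated by `exp (x² / 4)`. -/
lemma sq_le_exp (x : ℝ) : x ^ 2 ≤ 4 * Real.exp (x ^ 2 / 4) := by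
  have := Real.add_one_le_exp (x ^ 2 / 4)
  linarith

lemma pow_four_le_exp (x : ℝ) : x ^ 4 ≤ 32 * Real.exp (x ^ 2 / 4) := by
  have := Real.pow_div_factorial_le_exp (x ^ 2 / 4) (by positivity) 2
  norm_num [Nat.factorial] at this
  nlinarith

lemma one_le_exp_sq (x : ℝ) : 1 ≤ Real.exp (x ^ 2 / 4) := Real.one_le_exp (by positivity)

lemma phi_mul_exp (x : ℝ) :
    phi x * Real.exp (x ^ 2 / 4) = (√(2 * Real.pi))⁻¹ * Real.exp (-(1 / 4) * x ^ 2) := by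
  rw [phi_eq, mul_assoc, ← Real.exp_add]
  congr 2
  ring

lemma integrable_phi_mul_exp : Integrable fun x => phi x * Real.exp (x ^ 2 / 4) := by
  simp_rw [phi_mul_exp]
  exact (integrable_exp_neg_mul_sq (by norm_num)).const_mul _

/-- The weight halves the Gaussian exponent, so the integral equals `√2`; thus `exp (x² / 4)` serves
as a universal majorant for polynomial integrands. -/
lemma integral_phi_mul_exp_le : ∫ x, phi x * Real.exp (x ^ 2 / 4) ≤ 3 / 2 := by
  simp_rw [phi_mul_exp]
  have hpi := Real.pi_pos
  rw [integral_const_mul, integral_gaussian, ← Real.sqrt_inv, ← Real.sqrt_mul (by positivity),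
    Real.sqrt_le_left (by norm_num)]
  have : (2 * Real.pi)⁻¹ * (Real.pi / (1 / 4)) = 2 := by
    field_simp
    norm_num
  rw [this]
  norm_num

lemma integral_phi_mul_le {F : ℝ → ℝ} {C : ℝ} (hm : Measurable F)
    (hF : ∀ x, |F x| ≤ C * Real.exp (x ^ 2 / 4)) :
    Integrable (fun x => phi x * F x) ∧ ∫ x, phi x * F x ≤ 3 / 2 * C := by
  have hle : ∀ x, |phi x * F x| ≤ C * (phi x * Real.exp (x ^ 2 / 4)) := fun x => by
    rw [abs_mul, abs_of_pos (phi_pos x)]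
    have := mul_le_mul_of_nonneg_left (hF x) (phi_pos x).le
    linarith
  have hI : Integrable (fun x => phi x * F x) :=
    (integrable_phi_mul_exp.const_mul C).mono' (measurable_phi.mul hm).aestronglyMeasurable
      (Filter.Eventually.of_forall hle)
  refine ⟨hI, ?_⟩
  have hC : 0 ≤ C := by
    have h := (abs_nonneg _).trans (hF 0)
    simpa using h
  calc ∫ x, phi x * F x ≤ ∫ x, C * (phi x * Real.exp (x ^ 2 / 4)) :=
        integral_mono hI (integrable_phi_mul_exp.const_mul C)
          fun x => (le_abs_self _).trans (hle x)
    _ = C * ∫ x, phi x * Real.exp (x ^ 2 / 4) := integral_const_mul _ _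
    _ ≤ C * (3 / 2) := mul_le_mul_of_nonneg_left integral_phi_mul_exp_le hC
    _ = 3 / 2 * C := mul_comm _ _

/-- Upper bound for a Gaussian expectation, without measurability of the integrand. -/
lemma lintegral_gaussian_le {F H : ℝ → ℝ} {B : ℝ} (hF : ∀ x, 0 ≤ F x)
    (hFH : ∀ x, phi x * F x ≤ H x) (hH : Integrable H) (hB : ∫ x, H x ≤ B) :
    ∫⁻ x, ENNReal.ofReal (F x) ∂(gaussianReal 0 1) ≤ ENNReal.ofReal B := by
  rw [gaussianReal_of_var_ne_zero 0 one_ne_zero]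
  refine (lintegral_withDensity_le_lintegral_mul _ (measurable_gaussianPDF 0 1) _).trans ?_
  have h0 : ∀ x, 0 ≤ H x := fun x => (mul_nonneg (phi_pos x).le (hF x)).trans (hFH x)
  refine le_trans ?_ (ENNReal.ofReal_le_ofReal hB)
  rw [ofReal_integral_eq_lintegral_ofReal hH (Filter.Eventually.of_forall h0)]
  refine lintegral_mono fun x => ?_
  change ENNReal.ofReal (phi x) * ENNReal.ofReal (F x) ≤ _
  rw [← ENNReal.ofReal_mul (phi_pos x).le]
  exact ENNReal.ofReal_le_ofReal (hFH x)

lemma lintegral_gaussian_le_of_le_exp {F : ℝ → ℝ} {C : ℝ} (hC : 0 ≤ C) (hF : ∀ x, 0 ≤ F x)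
    (h : ∀ x, F x ≤ C * Real.exp (x ^ 2 / 4)) :
    ∫⁻ x, ENNReal.ofReal (F x) ∂(gaussianReal 0 1) ≤ ENNReal.ofReal (2 * C) := by
  refine lintegral_gaussian_le hF (H := fun x => C * (phi x * Real.exp (x ^ 2 / 4)))
    (fun x => ?_) (integrable_phi_mul_exp.const_mul C) ?_
  · have := mul_le_mul_of_nonneg_left (h x) (phi_pos x).le
    linarith
  · rw [integral_const_mul]
    have := mul_le_mul_of_nonneg_left integral_phi_mul_exp_le hC
    linarith

/-! ### Integrals of the Laplace density -/

lemma integral_exp_neg_mul_abs {c : ℝ} (hc : 0 < c) : ∫ u : ℝ, Real.exp (-(c * |u|)) = 2 / c := by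
  have h1 := integral_comp_abs (f := fun u => Real.exp (-c * u))
  have h2 := integral_exp_mul_Ioi (a := -c) (by linarith) 0
  simp only [← neg_mul]
  rw [h1, h2]
  simp
  field_simp

lemma integrable_exp_neg_mul_abs {c : ℝ} (hc : 0 < c) :
    Integrable fun u : ℝ => Real.exp (-(c * |u|)) := by
  by_contra h
  have := integral_exp_neg_mul_abs hc
  rw [integral_undef h] at this
  have h2 : 0 < 2 / c := by positivity
  linarith

/-! ### Convolutions with `phi` -/

lemma integrable_phi_sub (x : ℝ) : Integrable fun u => phi (x - u) :=
  integrable_phi.comp_sub_left x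

lemma measurable_phi_sub (x : ℝ) : Measurable fun u => phi (x - u) :=
  measurable_phi.comp (by fun_prop)

/-- Domination of integrands against `phi (x - u)`. -/
lemma integrable_phi_sub_mul {F : ℝ → ℝ} {C : ℝ} (x : ℝ) (hm : Measurable F)
    (hF : ∀ u, |F u| ≤ C * Real.exp ((x - u) ^ 2 / 4)) :
    Integrable (fun u => phi (x - u) * F u) ∧ ∫ u, phi (x - u) * F u ≤ 3 / 2 * C := by
  have h := integral_phi_mul_le (F := fun w => F (x - w)) (C := C) (hm.comp (by fun_prop))
    fun w => by simpa using hF (x - w)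
  have h1 := h.1.comp_sub_left x
  have h2 := integral_sub_left_eq_self (fun w => phi w * F (x - w)) volume x
  simp only [sub_sub_cancel] at h1 h2
  exact ⟨h1, h2 ▸ h.2⟩

lemma integrable_phi_sub_mul_density {γ : ℝ → ℝ} (hγ : Integrable γ) (x : ℝ) :
    Integrable fun u => phi (x - u) * γ u := by
  refine hγ.bdd_mul (c := 1) (measurable_phi_sub x).aestronglyMeasurable
    (Filter.Eventually.of_forall fun u => ?_)
  rw [Real.norm_eq_abs, abs_of_pos (phi_pos _)]
  exact phi_le_one _

lemma convPhi_eq_convolution (γ : ℝ → ℝ) :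
    convPhi γ = convolution γ phi (ContinuousLinearMap.mul ℝ ℝ) volume := by
  ext x
  simp only [convPhi, convolution, ContinuousLinearMap.mul_apply']
  exact integral_congr_ae (Filter.Eventually.of_forall fun u => mul_comm _ _)

lemma integrable_convPhi {γ : ℝ → ℝ} (hγ : Integrable γ) : Integrable (convPhi γ) := by
  rw [convPhi_eq_convolution]
  exact hγ.integrable_convolution _ integrable_phi

lemma integral_convPhi {γ : ℝ → ℝ} (hγ : Integrable γ) : ∫ x, convPhi γ x = ∫ u, γ u := by
  rw [convPhi_eq_convolution, integral_convolution _ hγ integrable_phi]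
  simp [integral_phi]

lemma measurable_convPhi {γ : ℝ → ℝ} (hγ : Measurable γ) : Measurable (convPhi γ) := by
  have h : StronglyMeasurable (Function.uncurry fun x u : ℝ => phi (x - u) * γ u) := by
    refine Measurable.stronglyMeasurable ?_
    exact (measurable_phi.comp (by fun_prop)).mul (hγ.comp (by fun_prop))
  exact h.integral_prod_right.measurable

/-- For a density which decreases in `|u|`, the second moment of the posterior about the origin is
at most `2 x² + 12`. -/
lemma secondMoment_le_of_antitone {γ : ℝ → ℝ} (hm : Measurable γ) (hpos : ∀ u, 0 ≤ γ u)
    (hanti : ∀ u v, |u| ≤ |v| → γ v ≤ γ u) (x : ℝ) :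
    Integrable (fun u => phi (x - u) * (u ^ 2 * γ u)) ∧
      ∫ u, phi (x - u) * (u ^ 2 * γ u) ≤ (2 * x ^ 2 + 12) * convPhi γ x := by
  -- Chosen from `u² ≤ 2 x² + 2 (x - u)²` and the bound `6` on the second moment of `phi`, so that
  -- the mean of `u² - M` under `phi (x - u)` is nonpositive.
  set M : ℝ := 2 * x ^ 2 + 12
  have hM : 0 ≤ M := by positivity
  have hexp : ∀ u : ℝ, (x - u) ^ 2 ≤ 4 * Real.exp ((x - u) ^ 2 / 4) := fun u => sq_le_exp (x - u)
  have hexp1 : ∀ u : ℝ, 1 ≤ Real.exp ((x - u) ^ 2 / 4) := fun u => one_le_exp_sq (x - u)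
  have hu2 : ∀ u : ℝ, u ^ 2 ≤ 2 * x ^ 2 + 2 * (x - u) ^ 2 := fun u => by
    nlinarith [sq_nonneg (2 * x - u)]
  have hγ0 : ∀ u, γ u ≤ γ 0 := fun u => hanti 0 u (by simp)
  have hu2γ : ∀ u, |u ^ 2 * γ u| ≤ (2 * x ^ 2 + 8) * γ 0 * Real.exp ((x - u) ^ 2 / 4) := fun u => by
    rw [abs_of_nonneg (mul_nonneg (sq_nonneg u) (hpos u))]
    have h1 : u ^ 2 ≤ (2 * x ^ 2 + 8) * Real.exp ((x - u) ^ 2 / 4) := by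
      nlinarith [hu2 u, hexp u, hexp1 u, sq_nonneg x]
    calc u ^ 2 * γ u ≤ ((2 * x ^ 2 + 8) * Real.exp ((x - u) ^ 2 / 4)) * γ 0 :=
          mul_le_mul h1 (hγ0 u) (hpos u) (by positivity)
      _ = _ := by ring
  have hI : Integrable fun u => phi (x - u) * (u ^ 2 * γ u) :=
    (integrable_phi_sub_mul x ((measurable_id.pow_const 2).mul hm) hu2γ).1
  have hγI : Integrable fun u => phi (x - u) * γ u :=
    (integrable_phi_sub_mul (C := γ 0) x hm fun u => by
      rw [abs_of_nonneg (hpos u)]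
      nlinarith [hγ0 u, hexp1 u, hpos 0]).1
  refine ⟨hI, ?_⟩
  have hW := integrable_phi_sub_mul (F := fun u => (x - u) ^ 2) (C := 4) x (by fun_prop)
    fun u => by rw [abs_of_nonneg (sq_nonneg _)]; exact hexp u
  have hone : ∫ u, phi (x - u) = 1 := by
    rw [integral_sub_left_eq_self (fun w => phi w) volume x, integral_phi]
  set g := γ (√M)
  have hg : 0 ≤ g := hpos _
  have hkey : ∀ u, phi (x - u) * (u ^ 2 * γ u) - M * (phi (x - u) * γ u) ≤
      g * (2 * (phi (x - u) * (x - u) ^ 2) - 12 * phi (x - u)) := fun u => by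
    -- Chebyshev's association argument: `u² - M` and `γ u - γ (√M)` have opposite signs, so `γ` may
    -- be replaced by the constant `g`.
    have h1 : (u ^ 2 - M) * (γ u - g) ≤ 0 := by
      rcases le_total (u ^ 2) M with h | h
      · have : g ≤ γ u := hanti u _ (by
          rw [abs_of_nonneg (Real.sqrt_nonneg M)]
          exact Real.abs_le_sqrt h)
        nlinarith
      · have : γ u ≤ g := hanti _ u (by
          rw [abs_of_nonneg (Real.sqrt_nonneg M), ← Real.sqrt_sq_eq_abs]
          exact Real.sqrt_le_sqrt h)
        nlinarith
    have h2 : (u ^ 2 - M) * g ≤ g * (2 * (x - u) ^ 2 - 12) := by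
      nlinarith [hu2 u]
    have h3 : (u ^ 2 - M) * γ u ≤ g * (2 * (x - u) ^ 2 - 12) := by linarith
    have := mul_le_mul_of_nonneg_left h3 (phi_pos (x - u)).le
    linarith
  have h4 := integral_mono (hI.sub (hγI.const_mul M))
    (((hW.1.const_mul 2).sub ((integrable_phi_sub x).const_mul 12)).const_mul g) hkey
  simp only [Pi.sub_apply] at h4
  rw [integral_sub hI (hγI.const_mul M), integral_const_mul, integral_const_mul,
    integral_sub (hW.1.const_mul 2) ((integrable_phi_sub x).const_mul 12), integral_const_mul,
    integral_const_mul, hone] at h4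
  have h5 : g * (2 * (∫ u, phi (x - u) * (x - u) ^ 2) - 12 * 1) ≤ 0 :=
    mul_nonpos_of_nonneg_of_nonpos hg (by linarith [hW.2])
  change _ ≤ M * ∫ u, phi (x - u) * γ u
  linarith

/-- Expectations of nonnegative functions under a posterior component. -/
lemma lintegral_postComponent_le {γ h : ℝ → ℝ} {x V : ℝ} (hγ : ∀ u, 0 ≤ γ u) (hh : ∀ u, 0 ≤ h u)
    (hm : Measurable γ) (hc : 0 < convPhi γ x)
    (hI : Integrable fun u => phi (x - u) * (h u * γ u))
    (hV : ∫ u, phi (x - u) * (h u * γ u) ≤ V * convPhi γ x) :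
    ∫⁻ u, ENNReal.ofReal (h u) ∂(postComponent γ x) ≤ ENNReal.ofReal V := by
  have hd : Measurable fun u => ENNReal.ofReal (phi (x - u) * γ u / convPhi γ x) :=
    (((measurable_phi_sub x).mul hm).div_const _).ennreal_ofReal
  refine (lintegral_withDensity_le_lintegral_mul _ hd _).trans ?_
  have hp : ∀ u, 0 ≤ phi (x - u) * γ u / convPhi γ x := fun u =>
    div_nonneg (mul_nonneg (phi_pos _).le (hγ u)) hc.le
  have hV' : ∫ u, phi (x - u) * (h u * γ u) / convPhi γ x ≤ V := by
    rw [integral_div, div_le_iff₀ hc]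
    exact hV
  refine le_trans (le_of_eq ?_) (ENNReal.ofReal_le_ofReal hV')
  rw [ofReal_integral_eq_lintegral_ofReal (hI.div_const _) (Filter.Eventually.of_forall fun u =>
    div_nonneg (mul_nonneg (phi_pos _).le (mul_nonneg (hh u) (hγ u))) hc.le)]
  refine lintegral_congr fun u => ?_
  rw [Pi.mul_apply, ← ENNReal.ofReal_mul (hp u)]
  congr 1
  ring

section

/-! ### The Cauchy slab -/

lemma integrable_slabDensity : Integrable slabDensity := by
  by_contra h
  have := integral_slabDensity
  rw [integral_undef h] at this
  norm_num at this

lemma slabDensity_eq' (u : ℝ) : slabDensity u = 0.05 / Real.pi / (1 + 0.0025 * u ^ 2) := by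
  rw [slabDensity_eq]
  norm_num [slabParam, div_eq_mul_inv]

/-- The Cauchy density varies at most polynomially. -/
lemma slabDensity_le_mul (u v : ℝ) :
    slabDensity u ≤ 2 * (1 + 0.0025 * (u - v) ^ 2) * slabDensity v := by
  have hpi := Real.pi_pos
  rw [slabDensity_eq', slabDensity_eq', mul_div_assoc', div_le_div_iff₀ (by positivity)
    (by positivity)]
  have h0 : 1 + 0.0025 * v ^ 2 ≤ 2 * (1 + 0.0025 * (u - v) ^ 2) * (1 + 0.0025 * u ^ 2) := by
    nlinarith [sq_nonneg (2 * u - v), mul_nonneg (sq_nonneg (u - v)) (sq_nonneg u)]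
  have h1 : 0 ≤ 0.05 / Real.pi := by positivity
  calc 0.05 / Real.pi * (1 + 0.0025 * v ^ 2)
      ≤ 0.05 / Real.pi * (2 * (1 + 0.0025 * (u - v) ^ 2) * (1 + 0.0025 * u ^ 2)) :=
        mul_le_mul_of_nonneg_left h0 h1
    _ = _ := by ring

lemma g1_pos (x : ℝ) : 0 < g1 x :=
  (component_bayes measurable_slabDensity slabDensity_pos integral_slabDensity x).1

lemma measurable_g1 : Measurable g1 := measurable_convPhi measurable_slabDensity

lemma integrable_g1 : Integrable g1 := integrable_convPhi integrable_slabDensity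

lemma integral_g1 : ∫ x, g1 x = 1 :=
  (integral_convPhi integrable_slabDensity).trans integral_slabDensity

lemma integral_phi_sub_mul_sq_le (x : ℝ) :
    Integrable (fun u => phi (x - u) * (x - u) ^ 2) ∧ ∫ u, phi (x - u) * (x - u) ^ 2 ≤ 6 := by
  have h := integrable_phi_sub_mul (F := fun u => (x - u) ^ 2) (C := 4) x (by fun_prop)
    fun u => by rw [abs_of_nonneg (sq_nonneg _)]; exact sq_le_exp _
  exact ⟨h.1, by linarith [h.2]⟩

lemma integral_phi_sub (x : ℝ) : ∫ u, phi (x - u) = 1 := by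
  rw [integral_sub_left_eq_self (fun w => phi w) volume x, integral_phi]

/-- The Cauchy density is nearly constant on the unit scale of the Gaussian: average the slow
variation bound `slabDensity_le_mul`, whose quadratic correction has small mean. -/
lemma slabDensity_le_g1 (x : ℝ) : slabDensity x ≤ 3 * g1 x := by
  obtain ⟨hW, hW6⟩ := integral_phi_sub_mul_sq_le x
  have hs := slabDensity_pos x
  have hle : ∀ u, slabDensity x / 2 * (phi (x - u) - 0.0025 * (phi (x - u) * (x - u) ^ 2)) ≤
      phi (x - u) * slabDensity u := fun u => by
    have h1 := slabDensity_le_mul x u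
    set t : ℝ := 0.0025 * (x - u) ^ 2
    have ht : 0 ≤ t := by positivity
    have h2 : slabDensity x / 2 * (1 - t) ≤ slabDensity u := by
      have h3 : slabDensity x / 2 ≤ (1 + t) * slabDensity u := by linarith
      rcases le_total t 1 with h | h
      · calc slabDensity x / 2 * (1 - t) ≤ (1 + t) * slabDensity u * (1 - t) :=
              mul_le_mul_of_nonneg_right h3 (by linarith)
          _ ≤ slabDensity u := by nlinarith [slabDensity_pos u, mul_nonneg ht ht]
      · nlinarith [slabDensity_pos u]
    have := mul_le_mul_of_nonneg_left h2 (phi_pos (x - u)).le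
    calc _ = phi (x - u) * (slabDensity x / 2 * (1 - t)) := by ring
      _ ≤ _ := this
  have h := integral_mono (((integrable_phi_sub x).sub (hW.const_mul 0.0025)).const_mul _)
    (integrable_phi_sub_mul_density integrable_slabDensity x) hle
  simp only [Pi.sub_apply] at h
  rw [integral_const_mul, integral_sub (integrable_phi_sub x) (hW.const_mul _),
    integral_const_mul, integral_phi_sub] at h
  change _ ≤ g1 x at h
  nlinarith

/-- The slab posterior concentrates around the observation. -/
lemma lintegral_slab_sub_sq_le (x : ℝ) :
    ∫⁻ u, ENNReal.ofReal ((u - x) ^ 2) ∂(postComponent slabDensity x) ≤ ENNReal.ofReal 37 := by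
  have hs := slabDensity_pos x
  have h := integrable_phi_sub_mul (F := fun u => (u - x) ^ 2 * slabDensity u)
    (C := 8.16 * slabDensity x) x ((by fun_prop : Measurable fun u : ℝ => (u - x) ^ 2).mul
      measurable_slabDensity) fun u => by
    have h1 := slabDensity_le_mul u x
    have h2 := sq_le_exp (x - u)
    have h4 := pow_four_le_exp (x - u)
    rw [abs_of_nonneg (mul_nonneg (sq_nonneg _) (slabDensity_pos u).le)]
    calc (u - x) ^ 2 * slabDensity u
        ≤ (u - x) ^ 2 * (2 * (1 + 0.0025 * (u - x) ^ 2) * slabDensity x) :=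
          mul_le_mul_of_nonneg_left h1 (sq_nonneg _)
      _ = (2 * (x - u) ^ 2 + 0.005 * (x - u) ^ 4) * slabDensity x := by ring
      _ ≤ (8.16 * Real.exp ((x - u) ^ 2 / 4)) * slabDensity x :=
          mul_le_mul_of_nonneg_right (by linarith) hs.le
      _ = _ := by ring
  refine lintegral_postComponent_le (fun u => (slabDensity_pos u).le) (fun u => sq_nonneg _)
    measurable_slabDensity (g1_pos x) h.1 (h.2.trans ?_)
  have := slabDensity_le_g1 x
  change _ ≤ 37 * g1 x
  nlinarith [g1_pos x]

/-! ### The Laplace spike -/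

variable {n : ℕ}

lemma twelve_mul_le_spikeParam (n : ℕ) : 12 * (n : ℝ) ≤ spikeParam n := by
  have h : (2.4 : ℝ) ≤ √(2 * Real.pi) := by
    refine Real.le_sqrt_of_sq_le ?_
    have := Real.pi_gt_three
    norm_num
    linarith
  have hn : (0 : ℝ) ≤ n := n.cast_nonneg
  unfold spikeParam
  nlinarith

lemma integrable_spikeDensity (hn : 0 < n) : Integrable (spikeDensity n) :=
  (integrable_exp_neg_mul_abs (spikeParam_pos hn)).const_mul _

lemma spikeDensity_le_of_abs_le (hn : 0 < n) (u v : ℝ) (h : |u| ≤ |v|) :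
    spikeDensity n v ≤ spikeDensity n u := by
  have := spikeParam_pos hn
  unfold spikeDensity
  gcongr

lemma g0_pos (hn : 0 < n) (x : ℝ) : 0 < g0 n x :=
  (component_bayes (measurable_spikeDensity n) (spikeDensity_pos hn) (integral_spikeDensity hn) x).1

lemma measurable_g0 (n : ℕ) : Measurable (g0 n) := measurable_convPhi (measurable_spikeDensity n)

/-- Half of the exponential rate is spent on absorbing the quadratic factor. -/
lemma sq_mul_exp_neg_le {c : ℝ} (hc : 0 < c) (u : ℝ) :
    u ^ 2 * Real.exp (-(c * |u|)) ≤ 8 / c ^ 2 * Real.exp (-(c / 2 * |u|)) := by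
  have h := Real.pow_div_factorial_le_exp (c * |u| / 2) (by positivity) 2
  norm_num [Nat.factorial] at h
  have hsplit : Real.exp (-(c * |u|)) = Real.exp (-(c / 2 * |u|)) * Real.exp (-(c * |u| / 2)) := by
    rw [← Real.exp_add]
    congr 1
    ring
  have h2 : (c * |u| / 2) ^ 2 = c ^ 2 * u ^ 2 / 4 := by
    rw [div_pow, mul_pow, sq_abs]
    norm_num
  have h3 : u ^ 2 ≤ 8 / c ^ 2 * Real.exp (c * |u| / 2) := by
    rw [div_mul_eq_mul_div, le_div_iff₀ (by positivity)]
    rw [h2] at h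
    linarith
  calc u ^ 2 * Real.exp (-(c * |u|))
      ≤ (8 / c ^ 2 * Real.exp (c * |u| / 2)) * Real.exp (-(c * |u|)) :=
        mul_le_mul_of_nonneg_right h3 (Real.exp_pos _).le
    _ = 8 / c ^ 2 * Real.exp (-(c / 2 * |u|)) := by
        rw [mul_assoc, ← Real.exp_add]
        congr 2
        ring

lemma phi_sub_eq (x u : ℝ) : phi (x - u) = phi x * Real.exp (x * u - u ^ 2 / 2) := by
  rw [phi_eq, phi_eq, mul_assoc, ← Real.exp_add]
  congr 2
  ring

/-- Pairing `u` with `-u` cancels the linear term of the tilt `exp (x u - u² / 2)` and leaves `2 -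
u²`, uniformly in `x`; the Laplace second moment is of order `n⁻²`. A constant this close to `1` is
needed: the excess enters the mean of the score and must stay below a drift of order `1 / T`. -/
lemma phi_le_mul_g0 (hn : 0 < n) (x : ℝ) : phi x ≤ (1 + 1 / (n : ℝ) ^ 2) * g0 n x := by
  set l := spikeParam n
  have hl : 0 < l := spikeParam_pos hn
  have hγ := integrable_spikeDensity hn
  have hsq : ∀ u, u ^ 2 * spikeDensity n u ≤ 4 / l * Real.exp (-(l / 2 * |u|)) := fun u => by
    have h := mul_le_mul_of_nonneg_left (sq_mul_exp_neg_le hl u) (by positivity : 0 ≤ l / 2)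
    calc _ = l / 2 * (u ^ 2 * Real.exp (-(l * |u|))) := by
          unfold spikeDensity
          ring
      _ ≤ _ := h
      _ = _ := by
          field_simp
          norm_num
  have hI1 := integrable_phi_sub_mul_density hγ x
  have hI2 : Integrable fun u => phi (x - -u) * spikeDensity n (-u) := hI1.comp_neg
  have he : ∫ u, phi (x - -u) * spikeDensity n (-u) = g0 n x :=
    integral_neg_eq_self (fun u => phi (x - u) * spikeDensity n u) volume
  have hle : ∀ u, phi x * (2 * spikeDensity n u - 4 / l * Real.exp (-(l / 2 * |u|))) ≤
      phi (x - u) * spikeDensity n u + phi (x - -u) * spikeDensity n (-u) := fun u => by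
    have h1 : spikeDensity n (-u) = spikeDensity n u := by simp [spikeDensity]
    rw [h1, phi_sub_eq x u, phi_sub_eq x (-u)]
    have e1 := Real.add_one_le_exp (x * u - u ^ 2 / 2)
    have e2 := Real.add_one_le_exp (x * -u - (-u) ^ 2 / 2)
    have h3 : 2 - u ^ 2 ≤ Real.exp (x * u - u ^ 2 / 2) + Real.exp (x * -u - (-u) ^ 2 / 2) := by
      nlinarith
    have h4 := mul_le_mul_of_nonneg_right h3 (spikeDensity_pos hn u).le
    have h5 := mul_le_mul_of_nonneg_left
      (by linarith [hsq u] : 2 * spikeDensity n u - 4 / l * Real.exp (-(l / 2 * |u|)) ≤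
        (Real.exp (x * u - u ^ 2 / 2) + Real.exp (x * -u - (-u) ^ 2 / 2)) * spikeDensity n u)
      (phi_pos x).le
    linarith
  have hE := (integrable_exp_neg_mul_abs (by positivity : 0 < l / 2)).const_mul (4 / l)
  have h := integral_mono (((hγ.const_mul 2).sub hE).const_mul (phi x)) (hI1.add hI2) hle
  simp only [Pi.add_apply, Pi.sub_apply] at h
  rw [integral_add hI1 hI2, he, integral_const_mul, integral_sub (hγ.const_mul 2) hE,
    integral_const_mul, integral_const_mul, integral_spikeDensity hn,
    integral_exp_neg_mul_abs (by positivity)] at h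
  change _ ≤ g0 n x + g0 n x at h
  have hn1 : (1 : ℝ) ≤ n := by exact_mod_cast hn
  have hl12 := twelve_mul_le_spikeParam n
  set t : ℝ := 1 / (n : ℝ) ^ 2
  have ht0 : 0 < t := by positivity
  have ht1 : t ≤ 1 := by
    rw [div_le_one (by positivity)]
    nlinarith
  have hl2 : 4 / l * (2 / (l / 2)) ≤ t / 9 := by
    have : 4 / l * (2 / (l / 2)) = 16 / l ^ 2 := by
      field_simp
      norm_num
    rw [this, div_div, div_le_div_iff₀ (by positivity) (by positivity)]
    nlinarith
  have h6 : phi x * (1 - t / 18) ≤ g0 n x := by nlinarith [phi_pos x]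
  have h7 := mul_le_mul_of_nonneg_left h6 (by positivity : 0 ≤ 1 + t)
  have h8 : 1 ≤ (1 + t) * (1 - t / 18) := by nlinarith
  nlinarith [phi_pos x]

lemma phi_le_two_mul_g0 (hn : 0 < n) (x : ℝ) : phi x ≤ 2 * g0 n x := by
  have h := phi_le_mul_g0 hn x
  have hn1 : (1 : ℝ) ≤ n := by exact_mod_cast hn
  have : 1 / (n : ℝ) ^ 2 ≤ 1 := by
    rw [div_le_one (by positivity)]
    nlinarith
  nlinarith [g0_pos hn x]

/-- In this range of `x` the tilt `exp (x u)` uses up at most half of the Laplace rate. -/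
lemma phi_sub_mul_spikeDensity_le (hn : 0 < n) {x : ℝ} (hx : |x| ≤ spikeParam n / 2) (u : ℝ) :
    phi (x - u) * spikeDensity n u ≤
      phi x * (spikeParam n / 2) * Real.exp (-(spikeParam n / 2 * |u|)) := by
  have hl := spikeParam_pos hn
  rw [phi_sub_eq, spikeDensity]
  have h1 : x * u ≤ spikeParam n / 2 * |u| := by
    calc x * u ≤ |x * u| := le_abs_self _
      _ = |x| * |u| := abs_mul _ _
      _ ≤ _ := mul_le_mul_of_nonneg_right hx (abs_nonneg _)
  have h2 : Real.exp (x * u - u ^ 2 / 2) * Real.exp (-(spikeParam n * |u|)) ≤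
      Real.exp (-(spikeParam n / 2 * |u|)) := by
    rw [← Real.exp_add]
    refine Real.exp_le_exp.2 ?_
    nlinarith [sq_nonneg u]
  have := mul_le_mul_of_nonneg_left h2
    (mul_nonneg (phi_pos x).le (by positivity : 0 ≤ spikeParam n / 2))
  linarith

lemma g0_le_two_mul_phi (hn : 0 < n) {x : ℝ} (hx : |x| ≤ spikeParam n / 2) :
    g0 n x ≤ 2 * phi x := by
  have hl := spikeParam_pos hn
  have h := integral_mono (integrable_phi_sub_mul_density (integrable_spikeDensity hn) x)
    ((integrable_exp_neg_mul_abs (by positivity : 0 < spikeParam n / 2)).const_mul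
      (phi x * (spikeParam n / 2))) (phi_sub_mul_spikeDensity_le hn hx)
  rw [integral_const_mul, integral_exp_neg_mul_abs (by positivity)] at h
  change g0 n x ≤ _ at h
  have e : phi x * (spikeParam n / 2) * (2 / (spikeParam n / 2)) = 2 * phi x := by
    field_simp
  linarith

lemma lintegral_spike_sq_le (hn : 0 < n) (x : ℝ) :
    ∫⁻ u, ENNReal.ofReal (u ^ 2) ∂(postComponent (spikeDensity n) x) ≤
      ENNReal.ofReal (2 * x ^ 2 + 12) := by
  have h := secondMoment_le_of_antitone (measurable_spikeDensity n)
    (fun u => (spikeDensity_pos hn u).le) (spikeDensity_le_of_abs_le hn) x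
  exact lintegral_postComponent_le (fun u => (spikeDensity_pos hn u).le) (fun u => sq_nonneg u)
    (measurable_spikeDensity n) (g0_pos hn x) h.1 h.2

/-- The spike posterior concentrates at zero. -/
lemma lintegral_spike_sq_le_div (hn : 0 < n) (x : ℝ) :
    ∫⁻ u, ENNReal.ofReal (u ^ 2) ∂(postComponent (spikeDensity n) x) ≤
      ENNReal.ofReal ((2 + x ^ 2 + x ^ 4) / (n : ℝ) ^ 2) := by
  have hl := spikeParam_pos hn
  have hl12 := twelve_mul_le_spikeParam n
  have hn1 : (1 : ℝ) ≤ n := by exact_mod_cast hn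
  rcases le_total |x| (spikeParam n / 2) with hx | hx
  · have hI := (secondMoment_le_of_antitone (measurable_spikeDensity n)
      (fun u => (spikeDensity_pos hn u).le) (spikeDensity_le_of_abs_le hn) x).1
    have hle : ∀ u, phi (x - u) * (u ^ 2 * spikeDensity n u) ≤
        phi x * (16 / spikeParam n) * Real.exp (-(spikeParam n / 2 / 2 * |u|)) := fun u => by
      have h1 := mul_le_mul_of_nonneg_left (phi_sub_mul_spikeDensity_le hn hx u) (sq_nonneg u)
      have h2 := mul_le_mul_of_nonneg_left
        (sq_mul_exp_neg_le (by positivity : 0 < spikeParam n / 2) u)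
        (mul_nonneg (phi_pos x).le (by positivity : 0 ≤ spikeParam n / 2))
      have e : phi x * (spikeParam n / 2) *
          (8 / (spikeParam n / 2) ^ 2 * Real.exp (-(spikeParam n / 2 / 2 * |u|))) =
          phi x * (16 / spikeParam n) * Real.exp (-(spikeParam n / 2 / 2 * |u|)) := by
        field_simp
        ring
      rw [e] at h2
      linarith
    have h := integral_mono hI ((integrable_exp_neg_mul_abs
      (by positivity : 0 < spikeParam n / 2 / 2)).const_mul (phi x * (16 / spikeParam n))) hle
    rw [integral_const_mul, integral_exp_neg_mul_abs (by positivity)] at h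
    refine (lintegral_postComponent_le (V := 2 / (n : ℝ) ^ 2)
      (fun u => (spikeDensity_pos hn u).le) (fun u => sq_nonneg u)
      (measurable_spikeDensity n) (g0_pos hn x) hI (h.trans ?_)).trans
      (ENNReal.ofReal_le_ofReal ?_)
    · have e : phi x * (16 / spikeParam n) * (2 / (spikeParam n / 2 / 2)) =
          phi x * (128 / spikeParam n ^ 2) := by
        field_simp
        ring
      rw [e]
      have h3 : 128 / spikeParam n ^ 2 ≤ 1 / (n : ℝ) ^ 2 := by
        rw [div_le_div_iff₀ (by positivity) (by positivity)]
        nlinarith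
      have h4 := phi_le_two_mul_g0 hn x
      calc phi x * (128 / spikeParam n ^ 2) ≤ (2 * g0 n x) * (1 / (n : ℝ) ^ 2) :=
            mul_le_mul h4 h3 (by positivity) (mul_pos two_pos (g0_pos hn x)).le
        _ = 2 / (n : ℝ) ^ 2 * convPhi (spikeDensity n) x := by
            change _ = _ * g0 n x
            ring
    · gcongr
      nlinarith [sq_nonneg x, sq_nonneg (x ^ 2)]
  -- Far from the origin the global bound `2 x² + 12` is enough, since `x² ≥ 36 n²` makes `x⁴ / n²`
  -- larger.
  · refine (lintegral_spike_sq_le hn x).trans (ENNReal.ofReal_le_ofReal ?_)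
    rw [le_div_iff₀ (by positivity)]
    have hx2 : 36 * (n : ℝ) ^ 2 ≤ x ^ 2 := by
      rw [← sq_abs x]
      nlinarith
    nlinarith [sq_nonneg x, mul_le_mul_of_nonneg_left hx2 (sq_nonneg x)]

/-- Either `|u| ≤ |x| / 2` and the Gaussian factor is small, or `|u| ≥ |x| / 2` and half of the
Laplace rate gives decay in `x`, the other half being kept for integration. Unlike
`g0_le_two_mul_phi`, this holds for all `x`. -/
lemma g0_le_exp (hn : 0 < n) (x : ℝ) :
    g0 n x ≤ Real.exp (-x ^ 2 / 8) + 2 * Real.exp (-(3 * n * |x|)) := by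
  have hl := spikeParam_pos hn
  have hl12 := twelve_mul_le_spikeParam n
  set l := spikeParam n
  have hle : ∀ u, phi (x - u) * spikeDensity n u ≤ Real.exp (-x ^ 2 / 8) * spikeDensity n u +
      Real.exp (-(3 * n * |x|)) * (l / 2) * Real.exp (-(l / 2 * |u|)) := fun u => by
    have hs := spikeDensity_pos hn u
    rcases le_total |u| (|x| / 2) with hu | hu
    · have h1 : phi (x - u) ≤ Real.exp (-x ^ 2 / 8) := by
        refine (phi_le_exp _).trans (Real.exp_le_exp.2 ?_)
        have h2 : |x| / 2 ≤ |x - u| := by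
          have := abs_sub_abs_le_abs_sub x u
          linarith
        have h3 : x ^ 2 / 4 ≤ (x - u) ^ 2 := by
          rw [← sq_abs x, ← sq_abs (x - u)]
          nlinarith [abs_nonneg x]
        linarith
      have h2 := mul_le_mul_of_nonneg_right h1 hs.le
      have : 0 < Real.exp (-(3 * n * |x|)) * (l / 2) * Real.exp (-(l / 2 * |u|)) := by positivity
      linarith
    · have h1 : spikeDensity n u ≤
          Real.exp (-(3 * n * |x|)) * (l / 2) * Real.exp (-(l / 2 * |u|)) := by
        have h2 : Real.exp (-(l * |u|)) ≤ Real.exp (-(3 * n * |x|)) * Real.exp (-(l / 2 * |u|)) := by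
          rw [← Real.exp_add]
          refine Real.exp_le_exp.2 ?_
          have h3 := mul_le_mul_of_nonneg_left hu (by positivity : 0 ≤ l / 2)
          have h4 := mul_le_mul_of_nonneg_right hl12 (abs_nonneg x)
          linarith
        have := mul_le_mul_of_nonneg_left h2 (by positivity : 0 ≤ l / 2)
        unfold spikeDensity
        linarith
      have h2 := mul_le_mul_of_nonneg_right (phi_le_one (x - u)) hs.le
      have : 0 < Real.exp (-x ^ 2 / 8) * spikeDensity n u := by positivity
      linarith
  have hI := integrable_exp_neg_mul_abs (by positivity : 0 < l / 2)
  have h := integral_mono (integrable_phi_sub_mul_density (integrable_spikeDensity hn) x)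
    (((integrable_spikeDensity hn).const_mul (Real.exp (-x ^ 2 / 8))).add
      (hI.const_mul (Real.exp (-(3 * n * |x|)) * (l / 2)))) hle
  simp only [Pi.add_apply] at h
  rw [integral_add ((integrable_spikeDensity hn).const_mul _) (hI.const_mul _),
    integral_const_mul, integral_const_mul, integral_spikeDensity hn,
    integral_exp_neg_mul_abs (by positivity)] at h
  change g0 n x ≤ _ at h
  have e : Real.exp (-(3 * n * |x|)) * (l / 2) * (2 / (l / 2)) =
      2 * Real.exp (-(3 * n * |x|)) := by
    field_simp
  linarith

end

section

/-! ### Risk of a coordinate -/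

variable {n : ℕ} {α : ℝ}

/-- The marginal density `(1 - α) g₀ + α g₁` of an observation. -/
def marginal (n : ℕ) (α x : ℝ) : ℝ := (1 - α) * g0 n x + α * g1 x

lemma marginal_pos (hn : 0 < n) (hα : α ∈ Set.Icc (0 : ℝ) 1) (x : ℝ) : 0 < marginal n α x :=
  (coord_bayes hn hα x).1

lemma postWeight_nonneg (hn : 0 < n) (hα : α ∈ Set.Icc (0 : ℝ) 1) (x : ℝ) :
    0 ≤ postWeight n α x :=
  div_nonneg (mul_nonneg hα.1 (g1_pos x).le) (marginal_pos hn hα x).le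

lemma one_sub_postWeight (hn : 0 < n) (hα : α ∈ Set.Icc (0 : ℝ) 1) (x : ℝ) :
    1 - postWeight n α x = (1 - α) * g0 n x / marginal n α x := by
  have h := marginal_pos hn hα x
  have e : postWeight n α x = α * g1 x / marginal n α x := rfl
  rw [e, eq_div_iff h.ne', sub_mul, div_mul_cancel₀ _ h.ne', marginal]
  ring

lemma postWeight_le_one (hn : 0 < n) (hα : α ∈ Set.Icc (0 : ℝ) 1) (x : ℝ) :
    postWeight n α x ≤ 1 := by
  have h := one_sub_postWeight hn hα x
  have h2 : 0 ≤ (1 - α) * g0 n x / marginal n α x :=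
    div_nonneg (mul_nonneg (by linarith [hα.2]) (g0_pos hn x).le) (marginal_pos hn hα x).le
  linarith

lemma postWeight_mono (hn : 0 < n) {α' : ℝ} (hα : α ∈ Set.Icc (0 : ℝ) 1)
    (hα' : α' ∈ Set.Icc (0 : ℝ) 1) (h : α ≤ α') (x : ℝ) :
    postWeight n α x ≤ postWeight n α' x := by
  have e : ∀ a, postWeight n a x = a * g1 x / marginal n a x := fun _ => rfl
  rw [e, e, div_le_div_iff₀ (marginal_pos hn hα x) (marginal_pos hn hα' x)]
  unfold marginal
  nlinarith [mul_nonneg (sub_nonneg.2 h) (mul_pos (g0_pos hn x) (g1_pos x)).le]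

lemma lintegral_sub_sq_le_of_prob {ν : Measure ℝ} [IsProbabilityMeasure ν] {b V : ℝ} (hV : 0 ≤ V)
    (h : ∫⁻ u, ENNReal.ofReal ((u - b) ^ 2) ∂ν ≤ ENNReal.ofReal V) (c : ℝ) :
    ∫⁻ u, ENNReal.ofReal ((u - c) ^ 2) ∂ν ≤ ENNReal.ofReal (2 * V + 2 * (b - c) ^ 2) := by
  calc ∫⁻ u, ENNReal.ofReal ((u - c) ^ 2) ∂ν
      ≤ ∫⁻ u, (ENNReal.ofReal 2 * ENNReal.ofReal ((u - b) ^ 2) +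
          ENNReal.ofReal (2 * (b - c) ^ 2)) ∂ν := by
        refine lintegral_mono fun u => ?_
        rw [← ENNReal.ofReal_mul (by norm_num), ← ENNReal.ofReal_add (by positivity)
          (by positivity)]
        refine ENNReal.ofReal_le_ofReal ?_
        nlinarith [sq_nonneg (u - b - (b - c))]
    _ = ENNReal.ofReal 2 * ∫⁻ u, ENNReal.ofReal ((u - b) ^ 2) ∂ν +
          ENNReal.ofReal (2 * (b - c) ^ 2) := by
        rw [lintegral_add_right _ measurable_const,
          lintegral_const_mul' _ _ ENNReal.ofReal_ne_top, lintegral_const, measure_univ, mul_one]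
    _ ≤ ENNReal.ofReal 2 * ENNReal.ofReal V + ENNReal.ofReal (2 * (b - c) ^ 2) := by gcongr
    _ = _ := by
        rw [← ENNReal.ofReal_mul (by norm_num), ← ENNReal.ofReal_add (by positivity)
          (by positivity)]

/-- The posterior risk of a coordinate with true value `μ` and observation `x`. -/
def coordRisk (n : ℕ) (α x μ : ℝ) : ℝ≥0∞ :=
  ∫⁻ u, ENNReal.ofReal ((u - μ) ^ 2) ∂(coordPosterior n α x)

/-- The slab term comes from its spread `37` around `x`, doubled when recentring at `μ`; only the
spike bound `V` depends on the regime. -/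
lemma coordRisk_le (hn : 0 < n) (hα : α ∈ Set.Icc (0 : ℝ) 1) {x μ V : ℝ} (hV : 0 ≤ V)
    (h : ∫⁻ u, ENNReal.ofReal ((u - μ) ^ 2) ∂(postComponent (spikeDensity n) x) ≤
      ENNReal.ofReal V) :
    coordRisk n α x μ ≤ ENNReal.ofReal ((1 - postWeight n α x) * V +
      postWeight n α x * (74 + 2 * (x - μ) ^ 2)) := by
  have hp : IsProbabilityMeasure (postComponent slabDensity x) :=
    (component_bayes measurable_slabDensity slabDensity_pos integral_slabDensity x).2.1
  have h1 := lintegral_sub_sq_le_of_prob (by norm_num) (lintegral_slab_sub_sq_le x) μ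
  have ha := postWeight_nonneg hn hα x
  have ha' := sub_nonneg.2 (postWeight_le_one hn hα x)
  rw [coordRisk, coordPosterior, lintegral_add_measure, lintegral_smul_measure,
    lintegral_smul_measure, ENNReal.ofReal_add (by positivity) (by positivity),
    ENNReal.ofReal_mul ha, ENNReal.ofReal_mul ha', smul_eq_mul, smul_eq_mul]
  norm_num at h1
  gcongr

lemma coordRisk_zero_le (hn : 0 < n) (hα : α ∈ Set.Icc (0 : ℝ) 1) (x : ℝ) :
    coordRisk n α x 0 ≤ ENNReal.ofReal ((2 + x ^ 2 + x ^ 4) / (n : ℝ) ^ 2 +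
      postWeight n α x * (74 + 2 * x ^ 2)) := by
  have h := coordRisk_le hn hα (x := x) (μ := 0) (V := (2 + x ^ 2 + x ^ 4) / (n : ℝ) ^ 2)
    (by positivity) (by simpa using lintegral_spike_sq_le_div hn x)
  refine h.trans (ENNReal.ofReal_le_ofReal ?_)
  have ha := postWeight_nonneg hn hα x
  have hv : 0 ≤ (2 + x ^ 2 + x ^ 4) / (n : ℝ) ^ 2 := by positivity
  rw [sub_zero]
  nlinarith

lemma inv_le_slabDensity (x : ℝ) : 1 / (100 * (1 + x ^ 2)) ≤ slabDensity x := by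
  have hpi := Real.pi_pos
  have hpi4 := Real.pi_le_four
  rw [slabDensity_eq', div_div, div_le_div_iff₀ (by positivity) (by positivity)]
  nlinarith [sq_nonneg x, mul_nonneg hpi.le (sq_nonneg x)]

lemma inv_le_g1 (x : ℝ) : 1 / (300 * (1 + x ^ 2)) ≤ g1 x := by
  have h1 := inv_le_slabDensity x
  have h2 := slabDensity_le_g1 x
  have e : 1 / (300 * (1 + x ^ 2)) = 1 / (100 * (1 + x ^ 2)) / 3 := by
    field_simp
    norm_num
  linarith

/-- Each of the two exponentials of `g0_le_exp` splits in two: one part beats the factor `n`, the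
other the polynomial. -/
lemma nat_mul_g0_mul_le (hn : 0 < n) {x : ℝ} (hL : 1 ≤ Real.log n)
    (hx : 16 * Real.log n ≤ x ^ 2) :
    n * g0 n x * ((1 + x ^ 2) * x ^ 2) ≤ 580 := by
  have hn1 : (1 : ℝ) ≤ n := by exact_mod_cast hn
  have hn0 : (0 : ℝ) < n := by linarith
  have hz1 : 1 ≤ |x| := by
    rw [← Real.sqrt_sq_eq_abs, Real.one_le_sqrt]
    linarith
  have A : (n : ℝ) * Real.exp (-x ^ 2 / 8) * ((1 + x ^ 2) * x ^ 2) ≤ 528 := by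
    have h1 : (n : ℝ) * Real.exp (-x ^ 2 / 16) ≤ 1 := by
      calc (n : ℝ) * Real.exp (-x ^ 2 / 16)
          = Real.exp (Real.log n) * Real.exp (-x ^ 2 / 16) := by rw [Real.exp_log hn0]
        _ = Real.exp (Real.log n - x ^ 2 / 16) := by
            rw [← Real.exp_add]
            congr 1
            ring
        _ ≤ 1 := Real.exp_le_one_iff.2 (by linarith)
    have h2 := Real.pow_div_factorial_le_exp (x ^ 2 / 16) (by positivity) 2
    have h3 := Real.pow_div_factorial_le_exp (x ^ 2 / 16) (by positivity) 1
    norm_num [Nat.factorial] at h2 h3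
    have h4 : (1 + x ^ 2) * x ^ 2 ≤ 528 * Real.exp (x ^ 2 / 16) := by nlinarith
    have e : Real.exp (-x ^ 2 / 8) =
        Real.exp (-x ^ 2 / 16) * Real.exp (-x ^ 2 / 16) := by
      rw [← Real.exp_add]
      congr 1
      ring
    have e2 : Real.exp (-x ^ 2 / 16) * Real.exp (x ^ 2 / 16) = 1 := by
      rw [← Real.exp_add, ← Real.exp_zero]
      congr 1
      ring
    calc (n : ℝ) * Real.exp (-x ^ 2 / 8) * ((1 + x ^ 2) * x ^ 2)
        ≤ (n : ℝ) * Real.exp (-x ^ 2 / 8) * (528 * Real.exp (x ^ 2 / 16)) := by gcongr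
      _ = 528 * (n * Real.exp (-x ^ 2 / 16)) *
          (Real.exp (-x ^ 2 / 16) * Real.exp (x ^ 2 / 16)) := by
          rw [e]
          ring
      _ ≤ 528 := by
          rw [e2]
          linarith
  have B : (n : ℝ) * Real.exp (-(3 * n * |x|)) * ((1 + x ^ 2) * x ^ 2) ≤ 26 := by
    have h1 : (n : ℝ) * Real.exp (-(n : ℝ)) ≤ 1 := by
      rw [Real.exp_neg, mul_inv_le_iff₀ (Real.exp_pos _)]
      linarith [Real.add_one_le_exp (n : ℝ)]
    have h2 := Real.pow_div_factorial_le_exp |x| (abs_nonneg x) 2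
    have h4 := Real.pow_div_factorial_le_exp |x| (abs_nonneg x) 4
    norm_num [Nat.factorial] at h2 h4
    rw [Even.pow_abs (by decide)] at h4
    have h5 : (1 + x ^ 2) * x ^ 2 ≤ 26 * Real.exp |x| := by nlinarith
    have h6 : Real.exp (-(3 * n * |x|)) ≤ Real.exp (-(n : ℝ)) * Real.exp (-|x|) := by
      rw [← Real.exp_add]
      refine Real.exp_le_exp.2 ?_
      nlinarith
    have e2 : Real.exp (-|x|) * Real.exp |x| = 1 := by
      rw [← Real.exp_add, ← Real.exp_zero]
      congr 1
      ring
    calc (n : ℝ) * Real.exp (-(3 * n * |x|)) * ((1 + x ^ 2) * x ^ 2)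
        ≤ (n : ℝ) * (Real.exp (-(n : ℝ)) * Real.exp (-|x|)) * (26 * Real.exp |x|) := by gcongr
      _ = 26 * (n * Real.exp (-(n : ℝ))) * (Real.exp (-|x|) * Real.exp |x|) := by ring
      _ ≤ 26 := by
          rw [e2]
          linarith
  have h := mul_le_mul_of_nonneg_right (mul_le_mul_of_nonneg_left (g0_le_exp hn x) hn0.le)
    (by positivity : 0 ≤ (1 + x ^ 2) * x ^ 2)
  linarith

/-- The spike keeps little weight at observations beyond the threshold `√(log n)`. -/
lemma one_sub_postWeight_mul_sq_le (hn : 0 < n) (hL : 1 ≤ Real.log n) (h0 : 1 / (n : ℝ) ≤ α)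
    (h1 : α ≤ 1) (x : ℝ) :
    (1 - postWeight n α x) * x ^ 2 ≤ 174000 * Real.log n := by
  have hn0 : (0 : ℝ) < n := by exact_mod_cast hn
  have hα0 : 0 < α := lt_of_lt_of_le (by positivity) h0
  have hα : α ∈ Set.Icc (0 : ℝ) 1 := ⟨hα0.le, h1⟩
  have ha := postWeight_nonneg hn hα x
  rcases le_total (x ^ 2) (16 * Real.log n) with hx | hx
  · nlinarith [sq_nonneg x]
  · have hg0 := g0_pos hn x
    have hg1 := g1_pos x
    have h2 : 1 - postWeight n α x ≤ n * g0 n x * (300 * (1 + x ^ 2)) := by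
      rw [one_sub_postWeight hn hα, div_le_iff₀ (marginal_pos hn hα x)]
      have h3 := inv_le_g1 x
      rw [div_le_iff₀ (by positivity)] at h3
      have h5 : 1 ≤ n * α := by
        rw [div_le_iff₀ hn0] at h0
        linarith
      have h6 : α * g1 x ≤ marginal n α x := by
        unfold marginal
        nlinarith [mul_nonneg (sub_nonneg.2 h1) hg0.le]
      calc (1 - α) * g0 n x ≤ g0 n x * (1 * 1) := by nlinarith
        _ ≤ g0 n x * ((n * α) * (g1 x * (300 * (1 + x ^ 2)))) := by gcongr
        _ = n * g0 n x * (300 * (1 + x ^ 2)) * (α * g1 x) := by ring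
        _ ≤ _ := mul_le_mul_of_nonneg_left h6 (by positivity)
    have h7 := mul_le_mul_of_nonneg_right h2 (sq_nonneg x)
    have h8 := nat_mul_g0_mul_le hn hL hx
    nlinarith

lemma coordRisk_signal_le (hn : 0 < n) (hL : 1 ≤ Real.log n) (h0 : 1 / (n : ℝ) ≤ α)
    (h1 : α ≤ 1) (x μ : ℝ) :
    coordRisk n α x μ ≤ ENNReal.ofReal (2000000 * Real.log n + 6 * (x - μ) ^ 2) := by
  have hn0 : (0 : ℝ) < n := by exact_mod_cast hn
  have hα0 : 0 < α := lt_of_lt_of_le (by positivity) h0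
  have hα : α ∈ Set.Icc (0 : ℝ) 1 := ⟨hα0.le, h1⟩
  have hp : IsProbabilityMeasure (postComponent (spikeDensity n) x) :=
    (component_bayes (measurable_spikeDensity n) (spikeDensity_pos hn)
      (integral_spikeDensity hn) x).2.1
  have hs := lintegral_sub_sq_le_of_prob (ν := postComponent (spikeDensity n) x) (b := 0)
    (V := 2 * x ^ 2 + 12) (by positivity) (by simpa using lintegral_spike_sq_le hn x) μ
  refine (coordRisk_le hn hα (by positivity) hs).trans (ENNReal.ofReal_le_ofReal ?_)
  have ha := postWeight_nonneg hn hα x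
  have ha' := postWeight_le_one hn hα x
  have h2 := one_sub_postWeight_mul_sq_le hn hL h0 h1 x
  have h3 : (0 - μ) ^ 2 ≤ 2 * x ^ 2 + 2 * (x - μ) ^ 2 := by nlinarith [sq_nonneg (2 * x - μ)]
  have h4 : (1 - postWeight n α x) * (2 * (2 * x ^ 2 + 12) + 2 * (0 - μ) ^ 2) ≤
      (1 - postWeight n α x) * (8 * x ^ 2 + 24 + 4 * (x - μ) ^ 2) :=
    mul_le_mul_of_nonneg_left (by linarith) (by linarith)
  nlinarith [sq_nonneg (x - μ)]

end

section

/-! ### Expected posterior weight at a null coordinate -/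

variable {n : ℕ} {α : ℝ}

lemma g1_le_slabDensity (x : ℝ) : g1 x ≤ 3 * slabDensity x := by
  obtain ⟨hW, hW6⟩ := integral_phi_sub_mul_sq_le x
  have hs := slabDensity_pos x
  have hle : ∀ u, phi (x - u) * slabDensity u ≤
      2 * slabDensity x * (phi (x - u) + 0.0025 * (phi (x - u) * (x - u) ^ 2)) := fun u => by
    have := mul_le_mul_of_nonneg_left (slabDensity_le_mul u x) (phi_pos (x - u)).le
    calc _ ≤ _ := this
      _ = _ := by ring
  have h := integral_mono (integrable_phi_sub_mul_density integrable_slabDensity x)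
    (((integrable_phi_sub x).add (hW.const_mul 0.0025)).const_mul _) hle
  simp only [Pi.add_apply] at h
  rw [integral_const_mul, integral_add (integrable_phi_sub x) (hW.const_mul _),
    integral_const_mul, integral_phi_sub] at h
  change g1 x ≤ _ at h
  nlinarith

/-- The tail `x⁻²` of the Cauchy slab exactly offsets the quadratic slab risk, so the integral over
`[-T, T]` is only linear in `T`. -/
lemma g1_mul_le (x : ℝ) : g1 x * (74 + 2 * x ^ 2) ≤ 42 := by
  have hpi := Real.pi_pos
  have hpi3 := Real.pi_gt_three
  have h := g1_le_slabDensity x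
  have h2 : slabDensity x * (74 + 2 * x ^ 2) ≤ 14 := by
    rw [slabDensity_eq', div_div, div_mul_eq_mul_div, div_le_iff₀ (by positivity)]
    nlinarith [sq_nonneg x, mul_nonneg (sub_nonneg.2 hpi3.le) (sq_nonneg x)]
  nlinarith [sq_nonneg x]

lemma marginal_ge (hn : 0 < n) (hα0 : 0 ≤ α) (hα2 : α ≤ 1 / 2) (x : ℝ) :
    g0 n x / 2 ≤ marginal n α x := by
  unfold marginal
  nlinarith [g0_pos hn x, mul_nonneg hα0 (g1_pos x).le]

lemma lintegral_postWeight_mul_le (hn : 0 < n) (hα0 : 0 ≤ α) (hα2 : α ≤ 1 / 2) {T : ℝ}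
    (hT : 0 ≤ T) (hT2 : 8 * Real.log n ≤ T ^ 2) :
    ∫⁻ x, ENNReal.ofReal (postWeight n α x * (74 + 2 * x ^ 2)) ∂(gaussianReal 0 1) ≤
      ENNReal.ofReal (336 * α * T + 135 / n) := by
  have hn0 : (0 : ℝ) < n := by exact_mod_cast hn
  have hα : α ∈ Set.Icc (0 : ℝ) 1 := ⟨hα0, by linarith⟩
  have hI1 : Integrable ((Set.Icc (-T) T).indicator fun _ : ℝ => 168 * α) :=
    (integrable_indicator_iff measurableSet_Icc).2 (integrableOn_const (by simp) enorm_ne_top)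
  have hI2 := integrable_phi_mul_exp.const_mul (90 / (n : ℝ))
  refine lintegral_gaussian_le (fun x => mul_nonneg (postWeight_nonneg hn hα x) (by positivity))
    (H := fun x => (Set.Icc (-T) T).indicator (fun _ : ℝ => 168 * α) x +
      90 / (n : ℝ) * (phi x * Real.exp (x ^ 2 / 4))) (fun x => ?_) (hI1.add hI2) ?_
  · by_cases hx : x ∈ Set.Icc (-T) T
    · rw [Set.indicator_of_mem hx]
      have h1 : phi x * postWeight n α x ≤ 4 * α * g1 x := by
        have e : postWeight n α x = α * g1 x / marginal n α x := rfl
        rw [e, mul_div_assoc', div_le_iff₀ (marginal_pos hn hα x)]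
        have h2 := marginal_ge hn hα0 hα2 x
        have h3 := phi_le_two_mul_g0 hn x
        have h4 : phi x ≤ 4 * marginal n α x := by linarith
        have := mul_le_mul_of_nonneg_right h4 (mul_nonneg hα0 (g1_pos x).le)
        linarith
      have h5 := mul_le_mul_of_nonneg_right h1 (by positivity : 0 ≤ 74 + 2 * x ^ 2)
      have h6 := mul_le_mul_of_nonneg_left (g1_mul_le x) (by positivity : 0 ≤ 4 * α)
      have h7 : 0 ≤ 90 / (n : ℝ) * (phi x * Real.exp (x ^ 2 / 4)) :=
        mul_nonneg (by positivity) (mul_pos (phi_pos x) (Real.exp_pos _)).le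
      linarith
    · rw [Set.indicator_of_notMem hx, zero_add]
      have hxT : T ^ 2 ≤ x ^ 2 := by
        rw [Set.mem_Icc, ← abs_le, not_le] at hx
        rw [← sq_abs x]
        nlinarith
      -- Of the available `exp (x² / 4)`, one half pays for the factor `1 / n` and the other for the
      -- quadratic.
      have h1 : (n : ℝ) ≤ Real.exp (x ^ 2 / 8) := by
        rw [← Real.log_le_iff_le_exp hn0]
        linarith
      have h2 : 74 + 2 * x ^ 2 ≤ 90 * Real.exp (x ^ 2 / 8) := by
        linarith [Real.add_one_le_exp (x ^ 2 / 8), Real.one_le_exp (by positivity : 0 ≤ x ^ 2 / 8)]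
      have h3 : postWeight n α x * (74 + 2 * x ^ 2) ≤ 90 / n * Real.exp (x ^ 2 / 4) := by
        rw [div_mul_eq_mul_div, le_div_iff₀ hn0]
        have h4 : Real.exp (x ^ 2 / 4) = Real.exp (x ^ 2 / 8) * Real.exp (x ^ 2 / 8) := by
          rw [← Real.exp_add]
          congr 1
          ring
        rw [h4]
        calc postWeight n α x * (74 + 2 * x ^ 2) * n
            ≤ 1 * (90 * Real.exp (x ^ 2 / 8)) * Real.exp (x ^ 2 / 8) := by
              gcongr
              exact postWeight_le_one hn hα x
          _ = _ := by ring
      have := mul_le_mul_of_nonneg_left h3 (phi_pos x).le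
      linarith
  · rw [integral_add hI1 hI2, integral_const_mul, integral_indicator measurableSet_Icc,
      setIntegral_const]
    have h1 : (volume : Measure ℝ).real (Set.Icc (-T) T) = 2 * T := by
      rw [Real.volume_real_Icc_of_le (by linarith)]
      ring
    rw [h1, smul_eq_mul]
    have h2 := mul_le_mul_of_nonneg_left integral_phi_mul_exp_le
      (by positivity : 0 ≤ 90 / (n : ℝ))
    have e : 90 / (n : ℝ) * (3 / 2) = 135 / n := by ring
    linarith

/-! ### The score of the marginal likelihood -/

/-- The contribution of an observation `x` to the derivative of the log-marginal likelihood. -/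
def score (n : ℕ) (α x : ℝ) : ℝ := (g1 x - g0 n x) / marginal n α x

lemma measurable_score (n : ℕ) (α : ℝ) : Measurable (score n α) :=
  (measurable_g1.sub (measurable_g0 n)).div
    (((measurable_g0 n).const_mul _).add (measurable_g1.const_mul _))

lemma score_le_inv (hn : 0 < n) (hα0 : 0 < α) (hα1 : α ≤ 1) (x : ℝ) : score n α x ≤ 1 / α := by
  rw [score, div_le_div_iff₀ (marginal_pos hn ⟨hα0.le, hα1⟩ x) hα0, marginal]
  nlinarith [g0_pos hn x]

lemma neg_two_le_score (hn : 0 < n) (hα0 : 0 < α) (hα2 : α ≤ 1 / 2) (x : ℝ) :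
    -2 ≤ score n α x := by
  rw [score, le_div_iff₀ (marginal_pos hn ⟨hα0.le, by linarith⟩ x)]
  nlinarith [marginal_ge hn hα0.le hα2 x, g1_pos x]

/-- The score is decreasing in `α`, and the right-hand side is its value at `α = 0`. -/
lemma score_le_ratio (hn : 0 < n) (hα0 : 0 < α) (hα1 : α ≤ 1) (x : ℝ) :
    score n α x ≤ g1 x / g0 n x - 1 := by
  have h0 := g0_pos hn x
  rw [score, div_sub_one h0.ne', div_le_div_iff₀ (marginal_pos hn ⟨hα0.le, hα1⟩ x) h0, marginal]
  nlinarith [mul_nonneg hα0.le (sq_nonneg (g1 x - g0 n x))]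

/-- Under `h` the marginal is at least `2 g₀`, which halves the bound of `score_le_ratio`. The gain,
a quarter of `g₁ / g₀`, is the source of the negative drift at null coordinates. -/
lemma score_le_of_dominant (hn : 0 < n) (hα0 : 0 < α) (hα2 : α ≤ 1 / 2) {x : ℝ}
    (h : g0 n x ≤ α * (g1 x - g0 n x)) :
    score n α x ≤ g1 x / g0 n x - 1 - g1 x / (4 * g0 n x) := by
  have h0 := g0_pos hn x
  have h1 := g1_pos x
  have h3 : 3 * g0 n x ≤ g1 x := by nlinarith
  have e : g1 x / g0 n x - 1 - g1 x / (4 * g0 n x) = (3 * g1 x - 4 * g0 n x) / (4 * g0 n x) := by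
    field_simp
    ring
  have hm : 2 * g0 n x ≤ marginal n α x := by
    unfold marginal
    linarith
  rw [e]
  calc score n α x ≤ (g1 x - g0 n x) / (2 * g0 n x) := by
        unfold score
        exact div_le_div_of_nonneg_left (by linarith) (by positivity) hm
    _ ≤ _ := by
        rw [div_le_div_iff₀ (by positivity) (by positivity)]
        nlinarith

/-- Where the score is positive, one factor is bounded by `1 / α` and the other by `2 g₁ / g₀`,
which is integrable against `phi`. This yields a second moment of order `1 / α` rather than `1 /
α²`. -/
lemma sq_score_le (hn : 0 < n) (hα0 : 0 < α) (hα2 : α ≤ 1 / 2) (x : ℝ) :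
    score n α x ^ 2 ≤ 4 + 2 / α * (g1 x / g0 n x) := by
  have h0 := g0_pos hn x
  have h1 := g1_pos x
  have hm := marginal_ge hn hα0.le hα2 x
  rcases le_total (score n α x) 0 with h | h
  · have := neg_two_le_score hn hα0 hα2 x
    have h2 : 0 ≤ 2 / α * (g1 x / g0 n x) := by positivity
    nlinarith
  · have h2 : score n α x ≤ 2 * (g1 x / g0 n x) := by
      calc score n α x ≤ g1 x / marginal n α x := by
            unfold score
            have := marginal_pos hn ⟨hα0.le, by linarith⟩ x
            gcongr
            linarith
        _ ≤ g1 x / (g0 n x / 2) := by gcongr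
        _ = _ := by field_simp
    have h3 := mul_le_mul (score_le_inv hn hα0 (by linarith) x) h2 h (by positivity)
    calc score n α x ^ 2 = score n α x * score n α x := sq _
      _ ≤ 1 / α * (2 * (g1 x / g0 n x)) := h3
      _ = 2 / α * (g1 x / g0 n x) := by ring
      _ ≤ _ := by linarith

lemma exp_le_of_neg_one_le {y : ℝ} (h1 : -1 ≤ y) (h2 : y ≤ 1) : Real.exp y ≤ 1 + y + y ^ 2 := by
  have := (abs_le.1 (Real.abs_exp_sub_one_sub_id_le (abs_le.2 ⟨h1, h2⟩))).2
  linarith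

/-- Between `T` and `2 T` the slab dominates the spike by a factor of order `n`. -/
lemma g0_le_of_mem_Icc (hn : 0 < n) (h0 : 1 / (n : ℝ) ≤ α) {T x : ℝ} (hT : 1 ≤ T)
    (hT2 : 8 * Real.log n ≤ T ^ 2) (hTn : 24000 * T ≤ (n : ℝ) ^ 2) (hTn' : T ≤ n)
    (hx : x ∈ Set.Icc T (2 * T)) :
    g0 n x ≤ α * (g1 x - g0 n x) ∧ 1 / (1500 * T ^ 2) ≤ g1 x := by
  have hn1 : (1 : ℝ) ≤ n := by exact_mod_cast hn
  have hn0 : (0 : ℝ) < n := by linarith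
  have hx0 : 0 ≤ x := by linarith [hx.1]
  have hx2 : x ^ 2 ≤ 4 * T ^ 2 := by nlinarith [hx.2]
  have hx1 : T ^ 2 ≤ x ^ 2 := by nlinarith [hx.1]
  have hg1 : 1 / (1500 * T ^ 2) ≤ g1 x := by
    refine le_trans ?_ (inv_le_g1 x)
    refine one_div_le_one_div_of_le (by positivity) ?_
    nlinarith
  refine ⟨?_, hg1⟩
  -- Here `x² ≥ 8 log n`, hence `exp (-x² / 2) ≤ n⁻⁴`.
  have hg0 : g0 n x ≤ 2 / (n : ℝ) ^ 4 := by
    have h1 := g0_le_two_mul_phi hn (x := x) (by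
      rw [abs_of_nonneg hx0]
      linarith [hx.2, twelve_mul_le_spikeParam n])
    have h2 : Real.exp (-x ^ 2 / 2) ≤ 1 / (n : ℝ) ^ 4 := by
      have : 1 / (n : ℝ) ^ 4 = Real.exp (-(4 * Real.log n)) := by
        rw [Real.exp_neg, one_div]
        congr 1
        rw [← Real.exp_log (pow_pos hn0 4), Real.log_pow]
        norm_num
      rw [this]
      exact Real.exp_le_exp.2 (by linarith)
    have h3 := phi_le_exp x
    calc g0 n x ≤ 2 * (1 / (n : ℝ) ^ 4) := by linarith
      _ = _ := by ring
  have h4 : (n + 1) * g0 n x ≤ g1 x := by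
    calc (n + 1) * g0 n x ≤ (2 * n) * (2 / (n : ℝ) ^ 4) :=
          mul_le_mul (by linarith) hg0 (g0_pos hn x).le (by positivity)
      _ = 4 / (n : ℝ) ^ 3 := by
          field_simp
          norm_num
      _ ≤ 1 / (1500 * T ^ 2) := by
          rw [div_le_div_iff₀ (by positivity) (by positivity)]
          have := mul_le_mul hTn hTn' (by linarith) (by positivity)
          nlinarith
      _ ≤ g1 x := hg1
  have h5 : 0 ≤ g1 x - g0 n x := by nlinarith [g0_pos hn x]
  have h6 := mul_le_mul_of_nonneg_right h0 h5
  rw [div_mul_eq_mul_div, one_mul, div_le_iff₀ hn0] at h6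
  nlinarith

/-- Exponential moment of the score at a null coordinate. -/
lemma lintegral_exp_score_le (hn : 0 < n) (h0 : 1 / (n : ℝ) ≤ α) (hα2 : α ≤ 1 / 2) {T : ℝ}
    (hT : 1 ≤ T) (hT2 : 8 * Real.log n ≤ T ^ 2) (hTn : 24000 * T ≤ (n : ℝ) ^ 2) (hTn' : T ≤ n) :
    ∫⁻ x, ENNReal.ofReal (Real.exp (α / (384000 * T) * score n α x)) ∂(gaussianReal 0 1) ≤
      ENNReal.ofReal (Real.exp (-(α / (384000 * T)) / (48000 * T))) := by
  have hn1 : (1 : ℝ) ≤ n := by exact_mod_cast hn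
  have hn0 : (0 : ℝ) < n := by linarith
  have hα0 : 0 < α := lt_of_lt_of_le (by positivity) h0
  -- Tuned so that the second order term `η² (4 + 4 / α)` costs at most half of the net drift `η /
  -- (24000 T)`.
  set η := α / (384000 * T) with hη
  have hη0 : 0 < η := by positivity
  have hηα : η ≤ α := div_le_self hα0.le (by linarith)
  set J := Set.Icc T (2 * T)
  -- One eighth of the lower bound `1 / (1500 T²)` for `g₁`; over the length `T` of `J` it
  -- integrates to the drift `1 / (12000 T)`.
  have hJ : Integrable (J.indicator fun _ : ℝ => 1 / (12000 * T ^ 2)) :=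
    (integrable_indicator_iff measurableSet_Icc).2 (integrableOn_const (by simp) enorm_ne_top)
  have hI0 : Integrable fun x => (1 + 1 / (n : ℝ) ^ 2) * g1 x - phi x :=
    (integrable_g1.const_mul _).sub integrable_phi
  have hI1 : Integrable fun x => (1 + 1 / (n : ℝ) ^ 2) * g1 x - phi x -
      J.indicator (fun _ : ℝ => 1 / (12000 * T ^ 2)) x :=
    hI0.sub hJ
  have hI2 : Integrable fun x => 4 * phi x + 4 / α * g1 x :=
    (integrable_phi.const_mul _).add (integrable_g1.const_mul _)
  have hI3 : Integrable fun x => phi x + η * ((1 + 1 / (n : ℝ) ^ 2) * g1 x - phi x -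
      J.indicator (fun _ : ℝ => 1 / (12000 * T ^ 2)) x) :=
    integrable_phi.add (hI1.const_mul η)
  refine lintegral_gaussian_le (fun x => (Real.exp_pos _).le)
    (H := fun x => phi x + η * ((1 + 1 / (n : ℝ) ^ 2) * g1 x - phi x -
      J.indicator (fun _ : ℝ => 1 / (12000 * T ^ 2)) x) + η ^ 2 * (4 * phi x + 4 / α * g1 x))
    (fun x => ?_) (hI3.add (hI2.const_mul (η ^ 2))) ?_
  · have hφ := phi_pos x
    have hg0 := g0_pos hn x
    have hg1 := g1_pos x
    have hle : η * score n α x ≤ 1 := by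
      calc η * score n α x ≤ η * (1 / α) :=
            mul_le_mul_of_nonneg_left (score_le_inv hn hα0 (by linarith) x) hη0.le
        _ ≤ α * (1 / α) := by gcongr
        _ = 1 := by field_simp
    have hge : -1 ≤ η * score n α x := by
      have := neg_two_le_score hn hα0 hα2 x
      nlinarith
    have h1 : phi x * score n α x ≤ (1 + 1 / (n : ℝ) ^ 2) * g1 x - phi x -
        J.indicator (fun _ : ℝ => 1 / (12000 * T ^ 2)) x := by
      have hr : phi x * (g1 x / g0 n x) ≤ (1 + 1 / (n : ℝ) ^ 2) * g1 x := by
        rw [mul_div_assoc', div_le_iff₀ hg0]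
        have := mul_le_mul_of_nonneg_right (phi_le_mul_g0 hn x) hg1.le
        linarith
      by_cases hx : x ∈ J
      · rw [Set.indicator_of_mem hx]
        obtain ⟨hd, hg⟩ := g0_le_of_mem_Icc hn h0 hT hT2 hTn hTn' hx
        have h2 := mul_le_mul_of_nonneg_left (score_le_of_dominant hn hα0 hα2 hd) hφ.le
        have h3 : g1 x / 8 ≤ phi x * (g1 x / (4 * g0 n x)) := by
          have hxl : |x| ≤ spikeParam n / 2 := by
            rw [abs_of_nonneg (by linarith [hx.1])]
            linarith [hx.2, twelve_mul_le_spikeParam n]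
          rw [mul_div_assoc', div_le_div_iff₀ (by norm_num) (by positivity)]
          have := mul_le_mul_of_nonneg_right (g0_le_two_mul_phi hn hxl) hg1.le
          linarith
        have h4 : 1 / (12000 * T ^ 2) ≤ g1 x / 8 := by
          have e : 1 / (12000 * T ^ 2) = 1 / (1500 * T ^ 2) / 8 := by
            field_simp
            norm_num
          rw [e]
          linarith
        linarith
      · rw [Set.indicator_of_notMem hx]
        have h2 := mul_le_mul_of_nonneg_left (score_le_ratio hn hα0 (by linarith) x) hφ.le
        linarith
    have h2 : phi x * score n α x ^ 2 ≤ 4 * phi x + 4 / α * g1 x := by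
      have h3 := mul_le_mul_of_nonneg_left (sq_score_le hn hα0 hα2 x) hφ.le
      have h4 : phi x * (2 / α * (g1 x / g0 n x)) ≤ 4 / α * g1 x := by
        have h5 : phi x / g0 n x ≤ 2 := by
          rw [div_le_iff₀ hg0]
          exact phi_le_two_mul_g0 hn x
        calc phi x * (2 / α * (g1 x / g0 n x)) = phi x / g0 n x * (2 / α * g1 x) := by ring
          _ ≤ 2 * (2 / α * g1 x) := by gcongr
          _ = _ := by ring
      linarith
    calc phi x * Real.exp (η * score n α x)
        ≤ phi x * (1 + η * score n α x + (η * score n α x) ^ 2) :=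
          mul_le_mul_of_nonneg_left (exp_le_of_neg_one_le hge hle) hφ.le
      _ = phi x + η * (phi x * score n α x) + η ^ 2 * (phi x * score n α x ^ 2) := by ring
      _ ≤ _ := by gcongr
  · have e1 : ∫ x, ((1 + 1 / (n : ℝ) ^ 2) * g1 x - phi x -
        J.indicator (fun _ : ℝ => 1 / (12000 * T ^ 2)) x) =
        1 / (n : ℝ) ^ 2 - 1 / (12000 * T) := by
      rw [integral_sub hI0 hJ,
        integral_sub (integrable_g1.const_mul _) integrable_phi, integral_const_mul, integral_g1,
        integral_phi, integral_indicator measurableSet_Icc, setIntegral_const,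
        Real.volume_real_Icc_of_le (by linarith), smul_eq_mul]
      field_simp
      ring
    have e2 : ∫ x, (4 * phi x + 4 / α * g1 x) = 4 + 4 / α := by
      rw [integral_add (integrable_phi.const_mul _) (integrable_g1.const_mul _),
        integral_const_mul, integral_const_mul, integral_g1, integral_phi]
      ring
    rw [integral_add hI3 (hI2.const_mul (η ^ 2)),
      integral_add integrable_phi (hI1.const_mul η), integral_const_mul, integral_const_mul, e1, e2,
      integral_phi]
    have h1 : 1 / (n : ℝ) ^ 2 ≤ 1 / (24000 * T) :=
      one_div_le_one_div_of_le (by positivity) hTn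
    have h2 : η ^ 2 * (4 + 4 / α) ≤ η * (1 / (48000 * T)) := by
      have h3 : η * (4 + 4 / α) ≤ 1 / (48000 * T) := by
        have h4 : 4 + 4 / α ≤ 8 / α := by
          rw [← sub_nonneg]
          have : 8 / α - (4 + 4 / α) = 4 * (1 - α) / α := by
            field_simp
            ring
          rw [this]
          exact div_nonneg (by linarith) hα0.le
        calc η * (4 + 4 / α) ≤ η * (8 / α) := mul_le_mul_of_nonneg_left h4 hη0.le
          _ = 1 / (48000 * T) := by
            rw [hη]
            field_simp
            norm_num
      calc η ^ 2 * (4 + 4 / α) = η * (η * (4 + 4 / α)) := by ring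
        _ ≤ _ := mul_le_mul_of_nonneg_left h3 hη0.le
    have h5 : η * (1 / (n : ℝ) ^ 2 - 1 / (12000 * T)) ≤ -(η * (2 * (1 / (48000 * T)))) := by
      have e : 1 / (24000 * T) = 2 * (1 / (48000 * T)) := by
        field_simp
        norm_num
      have e' : 1 / (12000 * T) = 4 * (1 / (48000 * T)) := by
        field_simp
        norm_num
      rw [e']
      rw [e] at h1
      nlinarith
    have h6 := Real.add_one_le_exp (-η / (48000 * T))
    have e3 : -η / (48000 * T) = -(η * (1 / (48000 * T))) := by ring
    rw [e3] at h6 ⊢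
    linarith

end

section

/-! ### The marginal maximum likelihood estimator -/

variable {n : ℕ} {α : ℝ}

/-- By concavity of the log-marginal likelihood, the total score is nonnegative to the left of the
maximiser. -/
lemma sum_score_nonneg {c : ℝ} (hn : 0 < n) (hα : α ∈ Set.Icc (0 : ℝ) 1)
    {αhat : (Fin n → ℝ) → ℝ} (h : IsMMLE c n αhat) (hc : c * Real.log n / n ≤ α)
    (X : Fin n → ℝ) (hX : α < αhat X) : 0 ≤ ∑ i, score n α (X i) := by
  obtain ⟨hmem, hmax⟩ := h X
  have hα' : αhat X ∈ Set.Icc (0 : ℝ) 1 := ⟨hα.1.trans hX.le, hmem.2⟩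
  have h1 : logMarginal n α X ≤ logMarginal n (αhat X) X := hmax ⟨hc, hα.2⟩
  have h2 : ∀ i, Real.log (marginal n (αhat X) (X i)) - Real.log (marginal n α (X i)) ≤
      (αhat X - α) * score n α (X i) := fun i => by
    have p1 := marginal_pos hn hα (X i)
    have p2 := marginal_pos hn hα' (X i)
    rw [← Real.log_div p2.ne' p1.ne']
    -- Concavity enters here, as the tangent line bound for the logarithm.
    refine (Real.log_le_sub_one_of_pos (div_pos p2 p1)).trans (le_of_eq ?_)
    rw [score, div_sub_one p1.ne', mul_div_assoc']
    congr 1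
    unfold marginal
    ring
  have h3 := Finset.sum_le_sum fun i (_ : i ∈ Finset.univ) => h2 i
  rw [Finset.sum_sub_distrib, ← Finset.mul_sum] at h3
  have h4 : 0 ≤ (αhat X - α) * ∑ i, score n α (X i) := by
    refine le_trans ?_ h3
    exact sub_nonneg.2 h1
  exact nonneg_of_mul_nonneg_right h4 (sub_pos.2 hX)

/-- The coordinates without signal. -/
def nullSet (θ : Fin n → ℝ) : Finset (Fin n) := Finset.univ.filter fun i => θ i = 0

lemma mem_nullSet {θ : Fin n → ℝ} {i : Fin n} : i ∈ nullSet θ ↔ θ i = 0 := by simp [nullSet]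

lemma card_compl_nullSet_le {θ : Fin n → ℝ} {s : ℕ} (hθ : θ ∈ sparseClass n s) :
    (nullSet θ)ᶜ.card ≤ s := by
  have e : (nullSet θ)ᶜ = Finset.univ.filter fun i => θ i ≠ 0 := by
    ext i
    simp [nullSet]
  rw [e]
  exact hθ

/-- The signals, however large, add at most `1 / α` each to the score. The conclusion is an event
free of the estimator, hence measurable although no measurability of the estimator is assumed. -/
lemma sum_null_score_ge {c : ℝ} (hn : 0 < n) (hα0 : 0 < α) (hα1 : α ≤ 1)
    {αhat : (Fin n → ℝ) → ℝ} (h : IsMMLE c n αhat) (hc : c * Real.log n / n ≤ α)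
    {θ : Fin n → ℝ} {s : ℕ} (hθ : θ ∈ sparseClass n s) (X : Fin n → ℝ) (hX : α < αhat X) :
    -(s / α) ≤ ∑ i ∈ nullSet θ, score n α (X i) := by
  have h1 := sum_score_nonneg hn ⟨hα0.le, hα1⟩ h hc X hX
  rw [← Finset.sum_add_sum_compl (nullSet θ)] at h1
  have h2 : ∑ i ∈ (nullSet θ)ᶜ, score n α (X i) ≤ s / α := by
    calc ∑ i ∈ (nullSet θ)ᶜ, score n α (X i) ≤ ∑ _i ∈ (nullSet θ)ᶜ, 1 / α :=
          Finset.sum_le_sum fun i _ => score_le_inv hn hα0 hα1 (X i)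
      _ = (nullSet θ)ᶜ.card * (1 / α) := by rw [Finset.sum_const, nsmul_eq_mul]
      _ ≤ s * (1 / α) := by
          have : ((nullSet θ)ᶜ.card : ℝ) ≤ s := by exact_mod_cast card_compl_nullSet_le hθ
          gcongr
      _ = s / α := by ring
  linarith

/-! ### Integration against the law of the sample -/

lemma lintegral_sampleLaw_eval (θ : Fin n → ℝ) (i : Fin n) {F : ℝ → ℝ≥0∞} (hF : Measurable F) :
    ∫⁻ X, F (X i) ∂(sampleLaw θ) = ∫⁻ x, F x ∂(gaussianReal (θ i) 1) :=
  (measurePreserving_eval (fun i : Fin n => gaussianReal (θ i) 1) i).lintegral_comp hF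

instance (θ : Fin n → ℝ) : IsProbabilityMeasure (sampleLaw θ) := by
  unfold sampleLaw
  infer_instance

lemma lintegral_gaussianReal_shift (μ : ℝ) {F : ℝ → ℝ≥0∞} (hF : Measurable F) :
    ∫⁻ x, F (x - μ) ∂(gaussianReal μ 1) = ∫⁻ x, F x ∂(gaussianReal 0 1) := by
  have h := gaussianReal_map_sub_const (μ := μ) (v := 1) μ
  rw [sub_self] at h
  rw [← h, lintegral_map hF (by fun_prop)]

lemma lintegral_sampleLaw_prod (θ : Fin n → ℝ) (S : Finset (Fin n)) {F : ℝ → ℝ≥0∞}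
    (hF : Measurable F) :
    ∫⁻ X, ∏ i ∈ S, F (X i) ∂(sampleLaw θ) = ∏ i ∈ S, ∫⁻ x, F x ∂(gaussianReal (θ i) 1) := by
  have hind : iIndepFun (fun i (X : Fin n → ℝ) => F (X i)) (sampleLaw θ) :=
    iIndepFun_pi fun _ => hF.aemeasurable
  rw [lintegral_prod_eq_prod_lintegral_of_indepFun S _ hind
    fun i => hF.comp (measurable_pi_apply i)]
  exact Finset.prod_congr rfl fun i _ => lintegral_sampleLaw_eval θ i hF

lemma measurableSet_score_event (θ : Fin n → ℝ) (b : ℝ) :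
    MeasurableSet {X : Fin n → ℝ | b ≤ ∑ i ∈ nullSet θ, score n α (X i)} :=
  measurableSet_le measurable_const
    (Finset.measurable_sum _ fun i _ => (measurable_score n α).comp (measurable_pi_apply i))

/-- Chernoff's bound for the total score of the null coordinates. -/
lemma sampleLaw_score_event_le (hn : 0 < n) (h0 : 1 / (n : ℝ) ≤ α) (hα2 : α ≤ 1 / 2) {T : ℝ}
    (hT : 1 ≤ T) (hT2 : 8 * Real.log n ≤ T ^ 2) (hTn : 24000 * T ≤ (n : ℝ) ^ 2) (hTn' : T ≤ n)
    (θ : Fin n → ℝ) (s : ℕ) :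
    sampleLaw θ {X | -(s / α) ≤ ∑ i ∈ nullSet θ, score n α (X i)} ≤
      ENNReal.ofReal (Real.exp ((s - (nullSet θ).card * α / (48000 * T)) / (384000 * T))) := by
  have hn0 : (0 : ℝ) < n := by exact_mod_cast hn
  have hα0 : 0 < α := lt_of_lt_of_le (by positivity) h0
  set η := α / (384000 * T) with hη
  have hη0 : 0 < η := by positivity
  set A := {X : Fin n → ℝ | -(s / α) ≤ ∑ i ∈ nullSet θ, score n α (X i)}
  have hA : MeasurableSet A := measurableSet_score_event θ _
  have hF : Measurable fun x => ENNReal.ofReal (Real.exp (η * score n α x)) :=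
    (Real.measurable_exp.comp ((measurable_score n α).const_mul η)).ennreal_ofReal
  calc sampleLaw θ A = ∫⁻ X, A.indicator 1 X ∂(sampleLaw θ) := (lintegral_indicator_one hA).symm
    _ ≤ ∫⁻ X, ENNReal.ofReal (Real.exp (η * (s / α))) *
          ∏ i ∈ nullSet θ, ENNReal.ofReal (Real.exp (η * score n α (X i))) ∂(sampleLaw θ) := by
        refine lintegral_mono fun X => ?_
        by_cases hX : X ∈ A
        · rw [Set.indicator_of_mem hX, ← ENNReal.ofReal_prod_of_nonneg
            fun i _ => (Real.exp_pos _).le, ← ENNReal.ofReal_mul (Real.exp_pos _).le,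
            ← Real.exp_sum, ← Finset.mul_sum, ← Real.exp_add, Pi.one_apply, ← ENNReal.ofReal_one]
          refine ENNReal.ofReal_le_ofReal (Real.one_le_exp ?_)
          have h1 : -(s / α) ≤ ∑ i ∈ nullSet θ, score n α (X i) := hX
          nlinarith
        · rw [Set.indicator_of_notMem hX]
          exact zero_le
    _ = ENNReal.ofReal (Real.exp (η * (s / α))) * ∏ i ∈ nullSet θ,
          ∫⁻ x, ENNReal.ofReal (Real.exp (η * score n α x)) ∂(gaussianReal (θ i) 1) := by
        rw [lintegral_const_mul' _ _ ENNReal.ofReal_ne_top, lintegral_sampleLaw_prod θ _ hF]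
    _ ≤ ENNReal.ofReal (Real.exp (η * (s / α))) * ∏ _i ∈ nullSet θ,
          ENNReal.ofReal (Real.exp (-η / (48000 * T))) := by
        gcongr with i hi
        rw [mem_nullSet.1 hi]
        exact lintegral_exp_score_le hn h0 hα2 hT hT2 hTn hTn'
    _ = _ := by
        rw [← ENNReal.ofReal_prod_of_nonneg fun i _ => (Real.exp_pos _).le,
          ← ENNReal.ofReal_mul (Real.exp_pos _).le, ← Real.exp_sum, ← Real.exp_add,
          Finset.sum_const, nsmul_eq_mul]
        congr 2
        rw [hη]
        field_simp
        ring

/-! ### Decomposition of the risk -/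

lemma lintegral_posterior (hn : 0 < n) (hα : α ∈ Set.Icc (0 : ℝ) 1) (X θ₀ : Fin n → ℝ) :
    ∫⁻ θ, ENNReal.ofReal (∑ i, (θ i - θ₀ i) ^ 2) ∂(posterior n α X) =
      ∑ i, coordRisk n α (X i) (θ₀ i) := by
  have hp : ∀ i, IsProbabilityMeasure (coordPosterior n α (X i)) := fun i =>
    (coord_bayes hn hα (X i)).2.1
  have hm : ∀ i, Measurable fun u : ℝ => ENNReal.ofReal ((u - θ₀ i) ^ 2) := fun i => by fun_prop
  have e : ∀ θ : Fin n → ℝ, ENNReal.ofReal (∑ i, (θ i - θ₀ i) ^ 2) =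
      ∑ i, ENNReal.ofReal ((θ i - θ₀ i) ^ 2) := fun θ =>
    ENNReal.ofReal_sum_of_nonneg fun i _ => sq_nonneg _
  simp_rw [e]
  rw [lintegral_finsetSum _ fun i _ => by fun_prop]
  refine Finset.sum_congr rfl fun i _ => ?_
  exact (measurePreserving_eval (fun i : Fin n => coordPosterior n α (X i)) i).lintegral_comp (hm i)

lemma plugInRisk_le (hn : 0 < n) (hL : 1 ≤ Real.log n) {αhat : (Fin n → ℝ) → ℝ}
    (h : ∀ X, 1 / (n : ℝ) ≤ αhat X ∧ αhat X ≤ 1) {θ : Fin n → ℝ} {s : ℕ}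
    (hθ : θ ∈ sparseClass n s) :
    plugInRisk αhat θ ≤ ENNReal.ofReal (s * (5000000 * Real.log n)) +
      ∫⁻ X, ∑ i ∈ nullSet θ, coordRisk n (αhat X) (X i) 0 ∂(sampleLaw θ) := by
  have hn0 : (0 : ℝ) < n := by exact_mod_cast hn
  set L := Real.log n
  have hα : ∀ X, αhat X ∈ Set.Icc (0 : ℝ) 1 := fun X =>
    ⟨le_trans (by positivity) (h X).1, (h X).2⟩
  have hm : ∀ i, Measurable fun x : ℝ => ENNReal.ofReal (2000000 * L + 6 * (x - θ i) ^ 2) :=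
    fun i => by fun_prop
  calc plugInRisk αhat θ
      = ∫⁻ X, ∑ i, coordRisk n (αhat X) (X i) (θ i) ∂(sampleLaw θ) :=
        lintegral_congr fun X => lintegral_posterior hn (hα X) X θ
    _ ≤ ∫⁻ X, (∑ i ∈ (nullSet θ)ᶜ, ENNReal.ofReal (2000000 * L + 6 * (X i - θ i) ^ 2) +
          ∑ i ∈ nullSet θ, coordRisk n (αhat X) (X i) 0) ∂(sampleLaw θ) := by
        refine lintegral_mono fun X => ?_
        rw [← Finset.sum_compl_add_sum (nullSet θ)]
        refine add_le_add (Finset.sum_le_sum fun i _ =>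
          coordRisk_signal_le hn hL (h X).1 (h X).2 (X i) (θ i)) (le_of_eq ?_)
        exact Finset.sum_congr rfl fun i hi => by rw [mem_nullSet.1 hi]
    _ = ∑ i ∈ (nullSet θ)ᶜ, ∫⁻ x, ENNReal.ofReal (2000000 * L + 6 * (x - θ i) ^ 2)
            ∂(gaussianReal (θ i) 1) +
          ∫⁻ X, ∑ i ∈ nullSet θ, coordRisk n (αhat X) (X i) 0 ∂(sampleLaw θ) := by
        rw [lintegral_add_left (by fun_prop), lintegral_finsetSum _ fun i _ => by fun_prop]
        congr 1
        exact Finset.sum_congr rfl fun i _ => lintegral_sampleLaw_eval θ i (hm i)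
    _ ≤ ∑ _i ∈ (nullSet θ)ᶜ, ENNReal.ofReal (5000000 * L) +
          ∫⁻ X, ∑ i ∈ nullSet θ, coordRisk n (αhat X) (X i) 0 ∂(sampleLaw θ) := by
        gcongr with i hi
        rw [lintegral_gaussianReal_shift (θ i)
          (F := fun x => ENNReal.ofReal (2000000 * L + 6 * x ^ 2)) (by fun_prop)]
        refine (lintegral_gaussian_le_of_le_exp (C := 2000000 * L + 24) (by positivity)
          (fun x => by positivity) fun x => ?_).trans (ENNReal.ofReal_le_ofReal (by linarith))
        nlinarith [sq_le_exp x, one_le_exp_sq x]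
    _ ≤ _ := by
        gcongr
        rw [Finset.sum_const, nsmul_eq_mul, ENNReal.ofReal_mul s.cast_nonneg,
          ENNReal.ofReal_natCast]
        gcongr
        exact card_compl_nullSet_le hθ

lemma sum_null_lintegral_le (θ : Fin n → ℝ) {F : ℝ → ℝ≥0∞} {B : ℝ}
    (hF : Measurable F) (h : ∫⁻ x, F x ∂(gaussianReal 0 1) ≤ ENNReal.ofReal B) :
    ∫⁻ X, ∑ i ∈ nullSet θ, F (X i) ∂(sampleLaw θ) ≤ ENNReal.ofReal (n * B) := by
  rw [lintegral_finsetSum _ fun i _ => by fun_prop]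
  calc ∑ i ∈ nullSet θ, ∫⁻ X, F (X i) ∂(sampleLaw θ)
      ≤ ∑ _i ∈ nullSet θ, ENNReal.ofReal B := by
        refine Finset.sum_le_sum fun i hi => ?_
        rw [lintegral_sampleLaw_eval θ i hF, mem_nullSet.1 hi]
        exact h
    _ = (nullSet θ).card * ENNReal.ofReal B := by rw [Finset.sum_const, nsmul_eq_mul]
    _ ≤ n * ENNReal.ofReal B := by
        gcongr
        exact (Finset.card_le_univ _).trans (by simp)
    _ = _ := by rw [ENNReal.ofReal_mul n.cast_nonneg, ENNReal.ofReal_natCast]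

/-- The null coordinates contribute at most a multiple of `n` to the risk. -/
lemma lintegral_null_le_trivial (hn : 0 < n) {αhat : (Fin n → ℝ) → ℝ}
    (h : ∀ X, αhat X ∈ Set.Icc (0 : ℝ) 1) (θ : Fin n → ℝ) :
    ∫⁻ X, ∑ i ∈ nullSet θ, coordRisk n (αhat X) (X i) 0 ∂(sampleLaw θ) ≤
      ENNReal.ofReal (n * 240) := by
  have hn1 : (1 : ℝ) ≤ n := by exact_mod_cast hn
  refine le_trans (lintegral_mono fun X => Finset.sum_le_sum fun i _ => ?_)
    (sum_null_lintegral_le θ (F := fun x => ENNReal.ofReal (76 + 3 * x ^ 2 + x ^ 4)) (B := 240)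
      (by fun_prop) ?_)
  · refine (coordRisk_zero_le hn (h X) (X i)).trans (ENNReal.ofReal_le_ofReal ?_)
    have h1 : (2 + X i ^ 2 + X i ^ 4) / (n : ℝ) ^ 2 ≤ 2 + X i ^ 2 + X i ^ 4 :=
      div_le_self (by positivity) (by nlinarith)
    have h2 := mul_le_mul_of_nonneg_right (postWeight_le_one hn (h X) (X i))
      (by positivity : 0 ≤ 74 + 2 * X i ^ 2)
    linarith
  · refine (lintegral_gaussian_le_of_le_exp (C := 120) (by norm_num) (fun x => by positivity)
      fun x => ?_).trans (ENNReal.ofReal_le_ofReal (by norm_num))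
    linarith [sq_le_exp x, one_le_exp_sq x, pow_four_le_exp x]

lemma measurable_postWeight (n : ℕ) (α : ℝ) : Measurable (postWeight n α) :=
  (measurable_g1.const_mul α).div
    (((measurable_g0 n).const_mul _).add (measurable_g1.const_mul _))

/-- The risk of the null coordinates, when the estimated weight is at most `α` outside of an
event `A`. -/
lemma lintegral_null_le (hn : 0 < n) (hα0 : 0 ≤ α) (hα2 : α ≤ 1 / 2) {T : ℝ}
    (hT : 0 ≤ T) (hT2 : 8 * Real.log n ≤ T ^ 2) {αhat : (Fin n → ℝ) → ℝ}
    (h : ∀ X, αhat X ∈ Set.Icc (0 : ℝ) 1) (θ : Fin n → ℝ) {A : Set (Fin n → ℝ)}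
    (hA : MeasurableSet A) (hαA : ∀ X, α < αhat X → X ∈ A) :
    ∫⁻ X, ∑ i ∈ nullSet θ, coordRisk n (αhat X) (X i) 0 ∂(sampleLaw θ) ≤
      ENNReal.ofReal (336 * (n * α * T) + 13787) + (n : ℝ≥0∞) ^ 2 * sampleLaw θ A := by
  have hn1 : (1 : ℝ) ≤ n := by exact_mod_cast hn
  have hn0 : (0 : ℝ) < n := by linarith
  have hα : α ∈ Set.Icc (0 : ℝ) 1 := ⟨hα0, by linarith⟩
  let F : ℝ → ℝ := fun x => (2 + x ^ 2 + x ^ 4) / (n : ℝ) ^ 2 + (74 + 2 * x ^ 2) ^ 2 / n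
  let G : ℝ → ℝ := fun x => postWeight n α x * (74 + 2 * x ^ 2)
  have hF0 : ∀ x, 0 ≤ F x := fun x => by positivity
  have hG0 : ∀ x, 0 ≤ G x := fun x => mul_nonneg (postWeight_nonneg hn hα x) (by positivity)
  have hFm : Measurable fun x => ENNReal.ofReal (F x) := by fun_prop
  have hGm : Measurable fun x => ENNReal.ofReal (G x) :=
    ((measurable_postWeight n α).mul (by fun_prop)).ennreal_ofReal
  have hFG : ∫⁻ x, (ENNReal.ofReal (F x) + ENNReal.ofReal (G x)) ∂(gaussianReal 0 1) ≤
      ENNReal.ofReal (336 * α * T + 13787 / n) := by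
    rw [lintegral_add_left hFm]
    have h1 : ∫⁻ x, ENNReal.ofReal (F x) ∂(gaussianReal 0 1) ≤
        ENNReal.ofReal (2 * (6826 / n)) := by
      refine lintegral_gaussian_le_of_le_exp (by positivity) hF0 fun x => ?_
      have h2 : (2 + x ^ 2 + x ^ 4) / (n : ℝ) ^ 2 ≤ (2 + x ^ 2 + x ^ 4) / n := by
        gcongr
        nlinarith
      have h3 : (2 + x ^ 2 + x ^ 4) + (74 + 2 * x ^ 2) ^ 2 ≤ 6826 * Real.exp (x ^ 2 / 4) := by
        nlinarith [sq_le_exp x, one_le_exp_sq x, pow_four_le_exp x]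
      calc F x ≤ (2 + x ^ 2 + x ^ 4) / n + (74 + 2 * x ^ 2) ^ 2 / n := by linarith
        _ = ((2 + x ^ 2 + x ^ 4) + (74 + 2 * x ^ 2) ^ 2) / n := by ring
        _ ≤ (6826 * Real.exp (x ^ 2 / 4)) / n := by gcongr
        _ = _ := by ring
    refine (add_le_add h1 (lintegral_postWeight_mul_le hn hα0 hα2 hT hT2)).trans (le_of_eq ?_)
    rw [← ENNReal.ofReal_add (by positivity) (by positivity)]
    congr 1
    ring
  calc ∫⁻ X, ∑ i ∈ nullSet θ, coordRisk n (αhat X) (X i) 0 ∂(sampleLaw θ)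
      ≤ ∫⁻ X, (∑ i ∈ nullSet θ, (ENNReal.ofReal (F (X i)) + ENNReal.ofReal (G (X i))) +
          A.indicator (fun _ => (n : ℝ≥0∞) ^ 2) X) ∂(sampleLaw θ) := by
        refine lintegral_mono fun X => ?_
        by_cases hX : α < αhat X
        · rw [Set.indicator_of_mem (hαA X hX)]
          have h1 : ∀ i ∈ nullSet θ, coordRisk n (αhat X) (X i) 0 ≤
              (ENNReal.ofReal (F (X i)) + ENNReal.ofReal (G (X i))) + n := fun i _ => by
            rw [← ENNReal.ofReal_natCast, ← ENNReal.ofReal_add (hF0 _) (hG0 _),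
              ← ENNReal.ofReal_add (add_nonneg (hF0 _) (hG0 _)) hn0.le]
            refine (coordRisk_zero_le hn (h X) (X i)).trans (ENNReal.ofReal_le_ofReal ?_)
            set y := 74 + 2 * X i ^ 2
            have hy : 0 ≤ y := by positivity
            have h2 := mul_le_mul_of_nonneg_right (postWeight_le_one hn (h X) (X i)) hy
            -- Separates the slab risk from the event: the square has bounded mean and is divided by
            -- `n`, while the constant `n` is paid only on `A`. This avoids Hölder's inequality.
            have h3 : y ≤ y ^ 2 / n + n := by
              rw [← sub_le_iff_le_add, le_div_iff₀ hn0]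
              nlinarith [sq_nonneg (y - n)]
            have h4 := hG0 (X i)
            change _ ≤ (2 + X i ^ 2 + X i ^ 4) / (n : ℝ) ^ 2 + y ^ 2 / n + _ + _
            linarith
          refine (Finset.sum_le_sum h1).trans ?_
          rw [Finset.sum_add_distrib]
          gcongr
          rw [Finset.sum_const, nsmul_eq_mul, sq]
          gcongr
          exact (Finset.card_le_univ _).trans (by simp)
        · refine le_trans (Finset.sum_le_sum fun i _ => ?_) le_self_add
          rw [← ENNReal.ofReal_add (hF0 _) (hG0 _)]
          refine (coordRisk_zero_le hn (h X) (X i)).trans (ENNReal.ofReal_le_ofReal ?_)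
          have h2 := mul_le_mul_of_nonneg_right
            (postWeight_mono hn (h X) hα (not_lt.1 hX) (X i))
            (by positivity : 0 ≤ 74 + 2 * X i ^ 2)
          have h3 : 0 ≤ (74 + 2 * X i ^ 2) ^ 2 / (n : ℝ) := by positivity
          change _ ≤ (2 + X i ^ 2 + X i ^ 4) / (n : ℝ) ^ 2 + (74 + 2 * X i ^ 2) ^ 2 / n +
            postWeight n α (X i) * (74 + 2 * X i ^ 2)
          linarith
    _ ≤ _ := by
        rw [lintegral_add_right _ (measurable_const.indicator hA),
          lintegral_indicator_const hA]
        gcongr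
        refine (sum_null_lintegral_le θ (hFm.add hGm) hFG).trans (le_of_eq ?_)
        congr 1
        field_simp

end

section

/-! ### The risk bound -/

variable {n : ℕ}

/-- The score event has probability at most `n⁻²` at the weight `K (s √(log n) + log² n) / n`. -/
lemma sq_mul_sampleLaw_score_event_le (hn : 0 < n) {K R α : ℝ} (hR : 1 ≤ R)
    (hRL : R ^ 2 = Real.log n) (hK : 10 ^ 12 ≤ K) (hRn : 72000 * R ≤ n) {s : ℕ}
    (hα : n * α = K * (s * R + R ^ 4)) (hα2 : α ≤ 1 / 2) (hs : 2 * (s : ℝ) ≤ n) {θ : Fin n → ℝ}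
    (hθ : θ ∈ sparseClass n s) :
    (n : ℝ≥0∞) ^ 2 * sampleLaw θ {X | -(s / α) ≤ ∑ i ∈ nullSet θ, score n α (X i)} ≤
      ENNReal.ofReal 1 := by
  have hn1 : (1 : ℝ) ≤ n := by exact_mod_cast hn
  have hn0 : (0 : ℝ) < n := by linarith
  have hs0 : (0 : ℝ) ≤ s := s.cast_nonneg
  have hR4 : 1 ≤ R ^ 4 := one_le_pow₀ hR
  have h1n : 1 / (n : ℝ) ≤ α := by
    rw [div_le_iff₀ hn0, mul_comm, hα]
    nlinarith [mul_nonneg hs0 (by linarith : 0 ≤ R)]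
  have hα0 : 0 < α := lt_of_lt_of_le (by positivity) h1n
  have h := sampleLaw_score_event_le hn h1n hα2 (T := 3 * R) (by linarith)
    (by nlinarith) (by nlinarith) (by linarith) θ s
  have hcard : (n : ℝ) / 2 ≤ (nullSet θ).card := by
    have h1 := card_compl_nullSet_le hθ
    have h2 := Finset.card_add_card_compl (nullSet θ)
    rw [Fintype.card_fin] at h2
    have h3 : (n : ℝ) = (nullSet θ).card + (nullSet θ)ᶜ.card := by exact_mod_cast h2.symm
    have h4 : ((nullSet θ)ᶜ.card : ℝ) ≤ s := by exact_mod_cast h1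
    linarith
  -- Since `n α / R = K (s + R³)`, the term in `K s` absorbs `s` and the term in `K R³`, divided by
  -- a multiple of `R`, beats `2 R² = 2 log n`. This requires `K ≥ 288000 * 2304000`, about `6.7 *
  -- 10 ^ 11`.
  have hexp : (s - (nullSet θ).card * α / (48000 * (3 * R))) / (384000 * (3 * R)) ≤
      -(2 * Real.log n) := by
    have h1 : n * α / 288000 / R ≤ (nullSet θ).card * α / (48000 * (3 * R)) := by
      have e : n * α / 288000 / R = (n / 2) * α / (48000 * (3 * R)) := by
        field_simp
        norm_num
      rw [e]
      gcongr
    have h2 : n * α / 288000 / R = K / 288000 * (s + R ^ 3) := by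
      rw [hα]
      field_simp
    rw [h2] at h1
    rw [div_le_iff₀ (by positivity), ← hRL]
    have hR3 : 0 ≤ R ^ 3 := by positivity
    nlinarith [mul_le_mul_of_nonneg_right hK hs0, mul_le_mul_of_nonneg_right hK hR3]
  calc _ ≤ (n : ℝ≥0∞) ^ 2 * ENNReal.ofReal (Real.exp (-(2 * Real.log n))) := by
        gcongr
        exact h.trans (ENNReal.ofReal_le_ofReal (Real.exp_le_exp.2 hexp))
    _ = ENNReal.ofReal ((n : ℝ) ^ 2 * Real.exp (-(2 * Real.log n))) := by
        rw [ENNReal.ofReal_mul (by positivity), ENNReal.ofReal_pow n.cast_nonneg,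
          ENNReal.ofReal_natCast]
    _ = ENNReal.ofReal 1 := by
        congr 1
        rw [Real.exp_neg, two_mul, Real.exp_add, Real.exp_log hn0]
        field_simp

/-- The comparison weight `α` is small enough that `n α √(log n)` meets the target rate, yet large
enough for the Chernoff exponent. The hypotheses on `n` and `s` keep it at most `1 / 2`, and `c ≤ K`
places it above the left endpoint of the maximisation interval. -/
lemma lintegral_null_le_of_isMMLE (hn : 0 < n) {c K : ℝ} (hc : 1 ≤ c) (hK : c + 10 ^ 12 ≤ K)
    (hL : 16 * K ^ 2 ≤ Real.log n) (hLn : 4 * K * Real.log n ^ 2 ≤ n)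
    {αhat : (Fin n → ℝ) → ℝ} (h : IsMMLE c n αhat) {θ : Fin n → ℝ} {s : ℕ}
    (hθ : θ ∈ sparseClass n s) (hs : s * Real.log n ≤ n) :
    ∫⁻ X, ∑ i ∈ nullSet θ, coordRisk n (αhat X) (X i) 0 ∂(sampleLaw θ) ≤
      ENNReal.ofReal (1008 * K * (s * Real.log n + Real.log n ^ 3) + 13788) := by
  have hn1 : (1 : ℝ) ≤ n := by exact_mod_cast hn
  have hn0 : (0 : ℝ) < n := by linarith
  have hs0 : (0 : ℝ) ≤ s := s.cast_nonneg
  have hK1 : (10 : ℝ) ^ 12 ≤ K := by linarith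
  have hK0 : 0 < K := by linarith
  set L := Real.log n with hLdef
  have hL2 : 2 ≤ L := by nlinarith
  set R := √L with hRdef
  have hRL : R ^ 2 = L := Real.sq_sqrt (by linarith)
  have hRK : 4 * K ≤ R := Real.le_sqrt_of_sq_le (by nlinarith)
  have hR1 : 1 ≤ R := by linarith
  have hR4 : R ^ 4 = L ^ 2 := by rw [← hRL]; ring
  have hRR : R ≤ R ^ 4 := by
    calc R = R ^ 1 := (pow_one R).symm
      _ ≤ R ^ 4 := pow_le_pow_right₀ hR1 (by norm_num)
  set α := K * (s * R + R ^ 4) / n with hαdef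
  have hα : n * α = K * (s * R + R ^ 4) := mul_div_cancel₀ _ hn0.ne'
  have hα0 : 0 < α := by positivity
  have hα2 : α ≤ 1 / 2 := by
    rw [hαdef, div_le_iff₀ hn0]
    have h1 : K * (s * R) ≤ n / 4 := by
      have h2 : 4 * K * (s * R) ≤ R * (s * R) :=
        mul_le_mul_of_nonneg_right hRK (by positivity)
      nlinarith
    rw [← hR4] at hLn
    linarith
  have hcα : c * L / n ≤ α := by
    rw [hαdef]
    have h1 : L ≤ s * R + R ^ 4 := by
      have : 0 ≤ s * R := by positivity
      rw [hR4]
      nlinarith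
    have h2 : c * L ≤ K * (s * R + R ^ 4) :=
      mul_le_mul (by linarith) h1 (by linarith) hK0.le
    gcongr
  have hmem : ∀ X, αhat X ∈ Set.Icc (0 : ℝ) 1 := fun X =>
    ⟨le_trans (by positivity) (h X).1.1, (h X).1.2⟩
  have hRn : 72000 * R ≤ n := by
    rw [← hR4] at hLn
    nlinarith
  have h1 := sq_mul_sampleLaw_score_event_le hn hR1 hRL hK1 hRn hα hα2 (by nlinarith) hθ
  have h2 := lintegral_null_le hn hα0.le hα2 (T := 3 * R) (by positivity) (by nlinarith) hmem θ
    (measurableSet_score_event (α := α) θ (-(s / α)))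
    fun X hX => sum_null_score_ge hn hα0 (by linarith) h hcα hθ X hX
  have hα' : 0 ≤ n * α * (3 * R) := by positivity
  refine (h2.trans (add_le_add_right h1 _)).trans ?_
  rw [← ENNReal.ofReal_add (by linarith) zero_le_one]
  refine ENNReal.ofReal_le_ofReal ?_
  have h3 : n * α * (3 * R) ≤ 3 * K * (s * L + L ^ 3) := by
    have e : n * α * (3 * R) = 3 * K * (s * R ^ 2 + R ^ 5) := by
      rw [hα]
      ring
    rw [e, hRL]
    gcongr
    -- The argument gives `log^(5/2) n` here, rounded up to `log³ n`.
    calc R ^ 5 ≤ R ^ 6 := pow_le_pow_right₀ hR1 (by norm_num)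
      _ = L ^ 3 := by
        rw [← hRL]
        ring
  linarith

lemma plugInRisk_le_of_isMMLE (hn : 0 < n) {c K : ℝ} (hc : 1 ≤ c) (hK : c + 10 ^ 12 ≤ K)
    (hL : 16 * K ^ 2 ≤ Real.log n) (hLn : 4 * K * Real.log n ^ 2 ≤ n)
    {αhat : (Fin n → ℝ) → ℝ} (h : IsMMLE c n αhat) {θ : Fin n → ℝ} {s : ℕ}
    (hθ : θ ∈ sparseClass n s) :
    plugInRisk αhat θ ≤
      ENNReal.ofReal (1009 * K * (s * Real.log n + Real.log n ^ 3)) := by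
  have hn0 : (0 : ℝ) < n := by exact_mod_cast hn
  have hs0 : (0 : ℝ) ≤ s := s.cast_nonneg
  have hK1 : (10 : ℝ) ^ 12 ≤ K := by linarith
  set L := Real.log n with hLdef
  have hL1 : 1 ≤ L := by nlinarith
  have hL3 : 1 ≤ L ^ 3 := one_le_pow₀ hL1
  have hsL : 0 ≤ s * L := by positivity
  have hmem : ∀ X, 1 / (n : ℝ) ≤ αhat X ∧ αhat X ≤ 1 := fun X => by
    refine ⟨le_trans ?_ (h X).1.1, (h X).1.2⟩
    gcongr
    nlinarith
  refine (plugInRisk_le hn hL1 hmem hθ).trans ?_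
  -- In the dense case `s log n ≥ n`, the trivial bound `240 n` on the nulls is already of the right
  -- order.
  rcases le_total (s * L) n with hs | hs
  · refine (add_le_add_right (lintegral_null_le_of_isMMLE hn hc hK hL hLn h hθ hs) _).trans ?_
    rw [← ENNReal.ofReal_add (by positivity) (by positivity)]
    refine ENNReal.ofReal_le_ofReal ?_
    rw [← hLdef]
    have h1 : (s * L + L ^ 3) * 10 ^ 12 ≤ (s * L + L ^ 3) * K := by gcongr
    linarith
  · refine (add_le_add_right (lintegral_null_le_trivial hn (fun X =>
      ⟨le_trans (by positivity) (hmem X).1, (hmem X).2⟩) θ) _).trans ?_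
    rw [← ENNReal.ofReal_add (by positivity) (by positivity)]
    refine ENNReal.ofReal_le_ofReal ?_
    have h1 : (s * L + L ^ 3) * 10 ^ 12 ≤ (s * L + L ^ 3) * K := by gcongr
    linarith

/-- Logarithms are eventually large, and negligible with respect to `n`. -/
lemma exists_forall_log_bounds (a b : ℝ) (hb : 0 < b) :
    ∃ N : ℕ, 0 < N ∧ ∀ n : ℕ, N ≤ n → a ≤ Real.log n ∧ b * Real.log n ^ 2 ≤ n := by
  have h1 : ∀ᶠ n : ℕ in Filter.atTop, a ≤ Real.log n :=
    (Real.tendsto_log_atTop.comp tendsto_natCast_atTop_atTop).eventually_ge_atTop a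
  have h2 : ∀ᶠ n : ℕ in Filter.atTop, b * Real.log n ^ 2 ≤ n := by
    have h := (Real.isLittleO_pow_log_id_atTop (n := 2)).comp_tendsto
      (tendsto_natCast_atTop_atTop (R := ℝ))
    filter_upwards [h.bound (inv_pos.2 hb)] with n hn
    simp only [Function.comp_apply, id, Real.norm_eq_abs, abs_pow, sq_abs, Nat.abs_cast] at hn
    rw [inv_mul_eq_div, le_div_iff₀ hb] at hn
    linarith
  obtain ⟨N, hN⟩ := Filter.eventually_atTop.1 (h1.and h2)
  exact ⟨N + 1, N.succ_pos, fun n hn => hN n (by omega)⟩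

end

end

end SSL

theorem theorem4 :
    ∃ 𝒞₀ : ℝ, 0 < 𝒞₀ ∧ ∀ 𝒞 : ℝ, 𝒞₀ ≤ 𝒞 →
      ∃ (C c₀ c₁ : ℝ) (N₀ : ℕ), 0 < C ∧ 0 < c₀ ∧ 0 < c₁ ∧ 0 < N₀ ∧
        ∀ n : ℕ, N₀ ≤ n → ∀ αhat : (Fin n → ℝ) → ℝ, SSL.IsMMLE 𝒞 n αhat →
          ∀ s : ℕ, (s : ℝ) ≤ c₀ * n →
            (c₁ * Real.log n ^ 2 ≤ s →
              (⨆ θ₀ ∈ SSL.sparseClass n s, SSL.plugInRisk αhat θ₀) ≤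
                ENNReal.ofReal (C * (s * Real.log n))) ∧
            (⨆ θ₀ ∈ SSL.sparseClass n s, SSL.plugInRisk αhat θ₀) ≤
              ENNReal.ofReal (C * (s * Real.log n + Real.log n ^ 3)) := by
  refine ⟨1, one_pos, fun c hc => ?_⟩
  set K : ℝ := c + 10 ^ 12
  have hK : 0 < K := by positivity
  obtain ⟨N, hN0, hN⟩ := SSL.exists_forall_log_bounds (16 * K ^ 2) (4 * K) (by positivity)
  -- With `c₁ = 1`, the condition `log² n ≤ s` gives `log³ n ≤ s log n`, which doubles the constant
  -- `1009 K`.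
  refine ⟨2018 * K, 1, 1, N, by positivity, one_pos, one_pos, hN0, fun n hn αhat h s _ => ?_⟩
  obtain ⟨hL, hLn⟩ := hN n hn
  have hL0 : 0 ≤ Real.log n := le_trans (by positivity) hL
  have hrisk : (⨆ θ₀ ∈ SSL.sparseClass n s, SSL.plugInRisk αhat θ₀) ≤
      ENNReal.ofReal (1009 * K * (s * Real.log n + Real.log n ^ 3)) :=
    iSup₂_le fun θ₀ hθ => SSL.plugInRisk_le_of_isMMLE (hN0.trans_le hn) hc le_rfl hL hLn h hθ
  refine ⟨fun hs => hrisk.trans (ENNReal.ofReal_le_ofReal ?_),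
    hrisk.trans (ENNReal.ofReal_le_ofReal ?_)⟩
  · have h1 : Real.log n ^ 3 ≤ s * Real.log n := by
      have := mul_le_mul_of_nonneg_right hs hL0
      linarith
    have := mul_le_mul_of_nonneg_left h1 (by positivity : 0 ≤ 1009 * K)
    linarith
  · have : 0 ≤ 1009 * K * (s * Real.log n + Real.log n ^ 3) := by positivity
    linarith
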